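/- Conventions. A *positive cone* is a cancellative $\mathbb R_{\ge 0}$-semimodule $P$ with a norm $\|\cdot\|:P\to\mathbb R_{\ge0}$ ($\|x\|=0\Rightarrow x=0$, homogeneity, triangle inequality) such that $\|x\|\le\|x+y\|$; it is ordered by $x\le y\iff\exists z\; x+z=y$, and $\mathcal BP=\{x\mid\|x\|\le1\}$. It is *complete* if every monotone sequence in $\mathcal BP$ has a least upper bound, lying in $\mathcal BP$. A linear map is *continuous* if it commutes with the least upper bounds of monotone sequences of the unit ball. $P'$ is the set of continuous linear maps $P\to\mathbb R_{\ge0}$; $P$ is *separated* if $P'$ separates its points. $\mathbf{Lin}$ is the category of separated complete cones and continuous linear maps $f$ with $f(\mathcal BP)\subseteq\mathcal BQ$. $P\multimap Q$ is the cone of all continuous linear maps $P\to Q$, with pointwise operations and norm $\sup_{x\in\mathcal BP}\|f(x)\|$. A *tensor product* $\otimes:\mathbf{Lin}^2\to\mathbf{Lin}$ is a functor with a bijection $\mathbf{Lin}(P\otimes Q,R)\cong\mathbf{Lin}(P,Q\multimap R)$ natural in $P,Q,R$; the image of $\mathrm{id}_{P\otimes Q}$ gives the universal bilinear map $(x,y)\mapsto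 x\otimes y$. Let $\mathbf R$ be a category with finite products and $F:\mathbf R\to\mathbf{Meas}$ a functor to measurable spaces that preserves finite products. A *measurable cone* $P$ is an object of $\mathbf{Lin}$ with, for each object $p$ of $\mathbf R$, a set $M(P)_p$ of maps $l:F(p)\to P'$ (tests) such that $r\mapsto l(r)(x)$ is measurable for all $x\in P$, and such that $l\circ F(h)\in M(P)_q$ for all $l\in M(P)_p$ and $h\in\mathbf R(q,p)$. A *measurable path* of arity $p$ is a map $\gamma:F(p)\to\mathcal BP$ such that $(r,s)\mapsto m(s)(\gamma(r))$ is measurable on $F(p)\times F(q)$ for all $q$ and $m\in M(P)_q$. $\mathbf{Lin}_m$ is the category of measurable cones and morphisms $f$ of $\mathbf{Lin}$ such that $f\circ\gamma$ is a measurable path whenever $\gamma$ is. The unit is $1=\mathbb R_{\ge0}$, whose only test of each arity is $r\mapsto\mathrm{id}$. The measurable function space $P\multimap_mQ$ is the cone of the $f\in P\multimap Q$ such that $\lambda f\in\mathbf{Lin}_m(P,Q)$ for some $\lambda>0$, with the induced norm, and with tests of arity $p$ the maps $r\mapsto(f\mapsto l(r)(f(\gamma(r))))$, where $\gamma$ is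 a measurable path of $P$ of arity $p$ and $l\in M(Q)_p$. For measurable cones $P,Q$, the measurable cone $P\otimes Q$ is the tensor product of the underlying cones, where a map $m:F(k)\to(P\otimes Q)'$ is a test iff $w\mapsto m(w)(z)$ is measurable for all $z\in P\otimes Q$ and $(r,s,w)\mapsto m(w)(\gamma(r)\otimes\delta(s))$ is measurable on $F(p)\times F(q)\times F(k)$ for all $p,q$ and all measurable paths $\gamma$ of $P$ and $\delta$ of $Q$, of arities $p$ and $q$. **Theorem.** A tensor product $\otimes$ on $\mathbf{Lin}$ exists. For every such $\otimes$, if $f\in\mathbf{Lin}_m(P,P')$ and $g\in\mathbf{Lin}_m(Q,Q')$ then $f\otimes g\in\mathbf{Lin}_m(P\otimes Q,P'\otimes Q')$, so that $\otimes$ restricts to a functor $\mathbf{Lin}_m^2\to\mathbf{Lin}_m$. With this functor, the unit $1$ and the function spaces $\multimap_m$, the category $\mathbf{Lin}_m$ is symmetric monoidal closed: there are structure isomorphisms of a symmetric monoidal category, which act by $(x\otimes y)\otimes z\mapsto x\otimes(y\otimes z)$, $\lambda\otimes x\mapsto\lambda x$, $x\otimes\lambda\mapsto\lambda x$ and $x\otimes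 y\mapsto y\otimes x$, and for each $Q$ the functor $-\otimes Q$ is left adjoint to $Q\multimap_m-$, through $f\mapsto(x\mapsto(y\mapsto f(x\otimes y)))$. -/

import Mathlib

open CategoryTheory CategoryTheory.Limits
open scoped NNReal

universe u v w x

noncomputable section

namespace Cones

/-- A positive cone: a cancellative `ℝ≥0`-semimodule with a monotone norm. -/
class PosCone (P : Type u) extends AddCommMonoid P, Module ℝ≥0 P where
  nrm : P → ℝ≥0
  eq_zero_of_nrm : ∀ a : P, nrm a = 0 → a = 0
  nrm_smul : ∀ (c : ℝ≥0) (a : P), nrm (c • a) = c * nrm a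
  nrm_add_le : ∀ a b : P, nrm (a + b) ≤ nrm a + nrm b
  nrm_le_add : ∀ a b : P, nrm a ≤ nrm (a + b)
  add_cancel : ∀ a b c : P, a + c = b + c → a = b

open PosCone

/-- The algebraic order of a cone. -/
def CLe {P : Type u} [PosCone P] (a b : P) : Prop := ∃ c, a + c = b

/-- A monotone sequence of elements of the unit ball. -/
structure BallChain {P : Type u} [PosCone P] (s : ℕ → P) : Prop where
  nrm_le : ∀ n, nrm (s n) ≤ 1
  mono : ∀ n, CLe (s n) (s (n + 1))

/-- `a` is the least upper bound of the sequence `s` for the algebraic order. -/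
structure IsSup {P : Type u} [PosCone P] (s : ℕ → P) (a : P) : Prop where
  le : ∀ n, CLe (s n) a
  least : ∀ b, (∀ n, CLe (s n) b) → CLe a b

/-- Every monotone sequence of the unit ball has a least upper bound, which is in the unit ball. -/
class CompleteCone (P : Type u) [PosCone P] : Prop where
  exists_sup : ∀ s : ℕ → P, BallChain s → ∃ a, IsSup s a ∧ nrm a ≤ 1

/-- Linear maps that commute with least upper bounds of monotone sequences of the unit ball. -/
structure ContLin (P : Type u) (Q : Type v) [PosCone P] [PosCone Q] extends P →ₗ[ℝ≥0] Q where
  cont : ∀ (s : ℕ → P) (a : P), BallChain s → IsSup s a → IsSup (fun n => toFun (s n)) (toFun a)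

instance : PosCone ℝ≥0 where
  nrm a := a
  eq_zero_of_nrm _ h := h
  nrm_smul _ _ := rfl
  nrm_add_le _ _ := le_rfl
  nrm_le_add _ _ := le_self_add
  add_cancel _ _ _ h := add_right_cancel h

/-- The dual of a cone: its continuous linear forms. -/
abbrev Dual (P : Type u) [PosCone P] := ContLin P ℝ≥0

section basics

variable {P : Type u} {Q : Type v} {S : Type w} [PosCone P] [PosCone Q] [PosCone S]

instance : FunLike (ContLin P Q) P Q where
  coe f := f.toFun
  coe_injective f g h := by
    cases f; cases g; congr; exact LinearMap.ext (congrFun h)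

@[ext] theorem ContLin.ext {f g : ContLin P Q} (h : ∀ a, f a = g a) : f = g := DFunLike.ext _ _ h

@[simp] theorem ContLin.coe_mk (f : P →ₗ[ℝ≥0] Q) (h) (a : P) : (⟨f, h⟩ : ContLin P Q) a = f a := rfl

theorem ContLin.map_add (f : ContLin P Q) (a b : P) : f (a + b) = f a + f b :=
  f.toLinearMap.map_add a b
theorem ContLin.map_smul (f : ContLin P Q) (c : ℝ≥0) (a : P) : f (c • a) = c • f a :=
  f.toLinearMap.map_smul c a
theorem ContLin.map_zero (f : ContLin P Q) : f 0 = 0 := f.toLinearMap.map_zero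
theorem ContLin.isSup (f : ContLin P Q) {s : ℕ → P} {a : P} (hs : BallChain s) (h : IsSup s a) :
    IsSup (fun n => f (s n)) (f a) := f.cont s a hs h

theorem nrm_zero : nrm (0 : P) = 0 := by
  have := nrm_smul (0 : ℝ≥0) (0 : P); simpa using this

theorem add_cancel_left {a b c : P} (h : c + a = c + b) : a = b :=
  add_cancel a b c (by rw [add_comm a, add_comm b, h])

theorem CLe.refl (a : P) : CLe a a := ⟨0, add_zero a⟩
theorem CLe.trans {a b c : P} : CLe a b → CLe b c → CLe a c := by
  rintro ⟨d, rfl⟩ ⟨e, rfl⟩; exact ⟨d + e, by rw [add_assoc]⟩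
theorem CLe.nrm_le {a b : P} : CLe a b → nrm a ≤ nrm b := by
  rintro ⟨d, rfl⟩; exact nrm_le_add _ _
theorem CLe.add {a b c d : P} : CLe a b → CLe c d → CLe (a + c) (b + d) := by
  rintro ⟨e, rfl⟩ ⟨f, rfl⟩; exact ⟨e + f, by abel⟩
theorem CLe.of_add_left {a b c : P} : CLe (c + a) (c + b) → CLe a b := by
  rintro ⟨d, h⟩; exact ⟨d, add_cancel_left (c := c) (by rw [← add_assoc, h])⟩
theorem CLe.smul (c : ℝ≥0) {a b : P} : CLe a b → CLe (c • a) (c • b) := by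
  rintro ⟨d, rfl⟩; exact ⟨c • d, by rw [smul_add]⟩
theorem CLe.antisymm {a b : P} : CLe a b → CLe b a → a = b := by
  rintro ⟨d, rfl⟩ ⟨e, h⟩
  have h0 : d + e = 0 := add_cancel_left (c := a) (by rw [← add_assoc, h, add_zero])
  have hd : d = 0 := by
    apply eq_zero_of_nrm
    have := nrm_le_add d e
    rw [h0, nrm_zero] at this
    exact le_antisymm this (zero_le)
  rw [hd, add_zero]
theorem CLe.map (f : P →ₗ[ℝ≥0] Q) {a b : P} : CLe a b → CLe (f a) (f b) := by
  rintro ⟨d, rfl⟩; exact ⟨f d, by rw [f.map_add]⟩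
theorem CLe.chain {s : ℕ → P} (h : ∀ n, CLe (s n) (s (n + 1))) {m n : ℕ} (hmn : m ≤ n) :
    CLe (s m) (s n) := by
  induction hmn with
  | refl => exact CLe.refl _
  | step _ ih => exact ih.trans (h _)

theorem IsSup.unique {s : ℕ → P} {a b : P} (h : IsSup s a) (h' : IsSup s b) : a = b :=
  CLe.antisymm (h.least _ h'.le) (h'.least _ h.le)

theorem IsSup.smul {s : ℕ → P} {a : P} (h : IsSup s a) (c : ℝ≥0) :
    IsSup (fun n => c • s n) (c • a) := by
  rcases eq_or_ne c 0 with rfl | hc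
  · exact ⟨fun n => by simpa using CLe.refl _, fun b hb => by simpa using hb 0⟩
  · refine ⟨fun n => (h.le n).smul c, fun b hb => ?_⟩
    have := (h.least (c⁻¹ • b) fun n => by
      simpa [smul_smul, inv_mul_cancel₀ hc] using (hb n).smul c⁻¹).smul c
    simpa [smul_smul, mul_inv_cancel₀ hc] using this

theorem IsSup.add {s t : ℕ → P} {a b : P} (hs : ∀ n, CLe (s n) (s (n + 1)))
    (ht : ∀ n, CLe (t n) (t (n + 1))) (h : IsSup s a) (h' : IsSup t b) :
    IsSup (fun n => s n + t n) (a + b) := by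
  refine ⟨fun n => (h.le n).add (h'.le n), fun c hc => ?_⟩
  have key : ∀ m n, CLe (s m + t n) c := fun m n =>
    ((CLe.chain hs (le_max_left m n)).add (CLe.chain ht (le_max_right m n))).trans (hc _)
  have step : ∀ n, CLe (a + t n) c := by
    intro n
    obtain ⟨d, rfl⟩ : CLe (t n) c := CLe.trans ⟨s 0, by rw [add_comm]⟩ (key 0 n)
    rw [add_comm]
    refine (CLe.refl _).add (h.least d fun m => ?_)
    exact CLe.of_add_left (c := t n) (by rw [add_comm (t n) (s m)]; exact key m n)
  obtain ⟨d, rfl⟩ : CLe a c := CLe.trans ⟨t 0, rfl⟩ (step 0)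
  exact (CLe.refl _).add (h'.least d fun n => CLe.of_add_left (step n))

/-- In `ℝ≥0`, least upper bounds are the usual ones. -/
theorem isSup_nnreal_iff {s : ℕ → ℝ≥0} {a : ℝ≥0} : IsSup s a ↔ IsLUB (Set.range s) a := by
  have hle : ∀ a b : ℝ≥0, CLe a b ↔ a ≤ b := fun a b =>
    ⟨by rintro ⟨c, rfl⟩; exact le_self_add, fun h => ⟨b - a, add_tsub_cancel_of_le h⟩⟩
  constructor
  · intro h
    refine ⟨by rintro _ ⟨n, rfl⟩; exact (hle _ _).1 (h.le n), fun b hb => (hle _ _).1 ?_⟩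
    exact h.least b fun n => (hle _ _).2 (hb ⟨n, rfl⟩)
  · intro h
    refine ⟨fun n => (hle _ _).2 (h.1 ⟨n, rfl⟩), fun b hb => (hle _ _).2 (h.2 ?_)⟩
    rintro _ ⟨n, rfl⟩; exact (hle _ _).1 (hb n)

theorem exists_sup_of_bdd [CompleteCone P] {s : ℕ → P} {c : ℝ≥0} (hc : ∀ n, nrm (s n) ≤ c)
    (hs : ∀ n, CLe (s n) (s (n + 1))) : ∃ a, IsSup s a ∧ nrm a ≤ c := by
  rcases eq_or_ne c 0 with rfl | h0
  · have : ∀ n, s n = 0 := fun n => eq_zero_of_nrm _ (le_antisymm (hc n) (zero_le))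
    exact ⟨0, ⟨fun n => by rw [this]; exact CLe.refl _, fun b _ => ⟨b, zero_add b⟩⟩,
      by rw [nrm_zero]⟩
  · obtain ⟨a, ha, ha1⟩ := CompleteCone.exists_sup (fun n => c⁻¹ • s n)
      ⟨fun n => by
        rw [nrm_smul, ← inv_mul_cancel₀ h0]; exact mul_le_mul_right (hc n) _,
       fun n => (hs n).smul _⟩
    refine ⟨c • a, by simpa [smul_smul, mul_inv_cancel₀ h0] using ha.smul c, ?_⟩
    rw [nrm_smul]; exact mul_le_of_le_one_right (zero_le) ha1

instance : CompleteCone ℝ≥0 where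
  exists_sup s hs := by
    have hb : BddAbove (Set.range s) := ⟨1, by rintro _ ⟨n, rfl⟩; exact hs.nrm_le n⟩
    refine ⟨⨆ n, s n, isSup_nnreal_iff.2 (isLUB_ciSup hb), ciSup_le hs.nrm_le⟩

/-- Linear maps out of a complete cone are bounded on the unit ball. -/
theorem bdd_of_linear [CompleteCone P] (f : P →ₗ[ℝ≥0] Q) :
    ∃ c, ∀ a, nrm a ≤ 1 → nrm (f a) ≤ c := by
  by_contra! hcon
  choose b hb1 hb using fun n : ℕ => hcon (4 ^ n)
  let t : ℕ → P := fun n => ∑ i ∈ Finset.range n, ((1 / 2 : ℝ≥0) ^ (i + 1)) • b i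
  have hsum : ∀ n, nrm (t n) + (1 / 2) ^ n ≤ 1 := by
    intro n
    induction n with
    | zero => simp [t, nrm_zero]
    | succ n ih =>
      have h1 : t (n + 1) = t n + ((1 / 2 : ℝ≥0) ^ (n + 1)) • b n := Finset.sum_range_succ _ _
      calc nrm (t (n + 1)) + (1 / 2) ^ (n + 1)
          ≤ (nrm (t n) + (1 / 2) ^ (n + 1) * 1) + (1 / 2) ^ (n + 1) := by
            rw [h1]
            refine add_le_add_left ((nrm_add_le _ _).trans (add_le_add_right ?_ _)) _
            rw [nrm_smul]; exact mul_le_mul_right (hb1 n) _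
        _ = nrm (t n) + (1 / 2) ^ n := by
            have : (1 / 2 : ℝ≥0) ^ n = (1 / 2) ^ (n + 1) + (1 / 2) ^ (n + 1) := by
              rw [← two_mul, pow_succ, mul_comm ((1 / 2 : ℝ≥0) ^ n), ← mul_assoc]; norm_num
            rw [this, mul_one, add_assoc]
        _ ≤ 1 := ih
  obtain ⟨a, ha, -⟩ := CompleteCone.exists_sup t
    ⟨fun n => le_self_add.trans (hsum n), fun n => ⟨_, (Finset.sum_range_succ _ _).symm⟩⟩
  have hlow : ∀ n : ℕ, (2 : ℝ≥0) ^ n ≤ 2 * nrm (f a) := by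
    intro n
    have h1 : CLe (((1 / 2 : ℝ≥0) ^ (n + 1)) • b n) a :=
      CLe.trans ⟨t n, by rw [add_comm]; exact (Finset.sum_range_succ _ _).symm⟩ (ha.le (n + 1))
    have h2 := (h1.map f).nrm_le
    rw [f.map_smul, nrm_smul] at h2
    calc (2 : ℝ≥0) ^ n = 2 * ((1 / 2) ^ (n + 1) * 4 ^ n) := by
          rw [show (4 : ℝ≥0) = 2 * 2 by norm_num, mul_pow, pow_succ, one_div, inv_pow]
          field_simp
      _ ≤ 2 * nrm (f a) := by
          gcongr
          exact le_trans (by gcongr; exact (hb n).le) h2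
  obtain ⟨n, hn⟩ := pow_unbounded_of_one_lt (2 * nrm (f a)) (show (1 : ℝ≥0) < 2 by norm_num)
  exact absurd (hlow n) (not_le.2 hn)

end basics

section function_cone

variable {P : Type u} {Q : Type v} {S : Type w} [PosCone P] [PosCone Q] [PosCone S]

theorem BallChain.map_mono {s : ℕ → P} (hs : BallChain s) (f : ContLin P Q) (n : ℕ) :
    CLe (f (s n)) (f (s (n + 1))) := (hs.mono n).map f.toLinearMap

/-! Algebraic operations on continuous linear maps are pointwise. -/

instance : Zero (ContLin P Q) where
  zero := ⟨0, fun _ _ _ _ => ⟨fun _ => CLe.refl _, fun b _ => ⟨b, zero_add b⟩⟩⟩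

instance : Add (ContLin P Q) where
  add f g := ⟨f.toLinearMap + g.toLinearMap, fun _ _ hs h =>
    IsSup.add (hs.map_mono f) (hs.map_mono g) (f.isSup hs h) (g.isSup hs h)⟩

instance : SMul ℝ≥0 (ContLin P Q) where
  smul c f := ⟨c • f.toLinearMap, fun _ _ hs h => (f.isSup hs h).smul c⟩

instance : SMul ℕ (ContLin P Q) where
  smul n f := (n : ℝ≥0) • f

@[simp] theorem ContLin.zero_apply (a : P) : (0 : ContLin P Q) a = 0 := rfl
@[simp] theorem ContLin.add_apply (f g : ContLin P Q) (a : P) : (f + g) a = f a + g a := rfl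
@[simp] theorem ContLin.smul_apply (c : ℝ≥0) (f : ContLin P Q) (a : P) : (c • f) a = c • f a := rfl

theorem ContLin.toLinearMap_injective :
    Function.Injective (ContLin.toLinearMap : ContLin P Q → (P →ₗ[ℝ≥0] Q)) := by
  intro f g h; ext a; exact LinearMap.congr_fun h a

instance : AddCommMonoid (ContLin P Q) :=
  ContLin.toLinearMap_injective.addCommMonoid ContLin.toLinearMap rfl (fun _ _ => rfl)
    (fun f n => by
      ext a
      change (n : ℝ≥0) • f a = n • f a
      exact Nat.cast_smul_eq_nsmul _ _ _)

instance : Module ℝ≥0 (ContLin P Q) :=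
  ContLin.toLinearMap_injective.module ℝ≥0
    ({ toFun := ContLin.toLinearMap, map_zero' := rfl, map_add' := fun _ _ => rfl } :
      ContLin P Q →+ (P →ₗ[ℝ≥0] Q)) (fun _ _ => rfl)

/-- The norm `sup {‖f a‖ | ‖a‖ ≤ 1}`. -/
def opNrm (f : ContLin P Q) : ℝ≥0 := ⨆ a : {a : P // nrm a ≤ 1}, nrm (f a)

theorem bddAbove_opNrm [CompleteCone P] (f : ContLin P Q) :
    BddAbove (Set.range fun a : {a : P // nrm a ≤ 1} => nrm (f a)) := by
  obtain ⟨c, hc⟩ := bdd_of_linear f.toLinearMap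
  exact ⟨c, by rintro _ ⟨a, rfl⟩; exact hc a.1 a.2⟩

instance : Nonempty {a : P // nrm a ≤ 1} := ⟨⟨0, by rw [nrm_zero]; exact zero_le⟩⟩

theorem le_opNrm [CompleteCone P] (f : ContLin P Q) {a : P} (ha : nrm a ≤ 1) :
    nrm (f a) ≤ opNrm f := le_ciSup (bddAbove_opNrm f) (⟨a, ha⟩ : {a : P // nrm a ≤ 1})

theorem opNrm_le (f : ContLin P Q) {c : ℝ≥0} (h : ∀ a, nrm a ≤ 1 → nrm (f a) ≤ c) :
    opNrm f ≤ c := ciSup_le fun a => h a.1 a.2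

theorem nrm_apply_le [CompleteCone P] (f : ContLin P Q) (a : P) :
    nrm (f a) ≤ opNrm f * nrm a := by
  rcases eq_or_ne (nrm a) 0 with h0 | h0
  · rw [eq_zero_of_nrm a h0, f.map_zero, nrm_zero]; exact zero_le
  · have h1 : nrm (f ((nrm a)⁻¹ • a)) ≤ opNrm f :=
      le_opNrm f (by rw [nrm_smul, inv_mul_cancel₀ h0])
    rw [f.map_smul, nrm_smul] at h1
    calc nrm (f a) = ((nrm a)⁻¹ * nrm (f a)) * nrm a := by field_simp
      _ ≤ opNrm f * nrm a := by gcongr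

/-- The cone of continuous linear maps. -/
instance [CompleteCone P] : PosCone (ContLin P Q) where
  nrm := opNrm
  eq_zero_of_nrm f h := by
    ext a
    apply eq_zero_of_nrm
    have := nrm_apply_le f a
    rw [h, zero_mul] at this
    exact le_antisymm this zero_le
  nrm_smul c f := by
    simp only [opNrm, ContLin.smul_apply, nrm_smul]
    exact (NNReal.mul_iSup _ _).symm
  nrm_add_le f g := opNrm_le _ fun a ha =>
    (nrm_add_le _ _).trans (add_le_add (le_opNrm f ha) (le_opNrm g ha))
  nrm_le_add f g := opNrm_le _ fun a ha => (nrm_le_add _ _).trans (le_opNrm (f + g) ha)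
  add_cancel f g h e := by
    ext a; exact add_cancel _ _ (h a) (by rw [← ContLin.add_apply, e, ContLin.add_apply])

theorem nrm_contLin [CompleteCone P] (f : ContLin P Q) : nrm f = opNrm f := rfl

/-- The algebraic order of a function cone is the pointwise order. -/
theorem cle_of_pointwise {f g : ContLin P Q} (h : ∀ a, CLe (f a) (g a)) :
    ∃ k : ContLin P Q, f + k = g := by
  choose k hk using h
  refine ⟨⟨⟨⟨k, fun a b => ?_⟩, fun c a => ?_⟩, fun s a hs ha => ?_⟩, ContLin.ext hk⟩
  · refine add_cancel_left (c := f (a + b)) ?_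
    rw [hk, g.map_add, ← hk, ← hk, f.map_add]; abel
  · refine add_cancel_left (c := f (c • a)) ?_
    simp only [RingHom.id_apply]
    rw [hk, g.map_smul, ← hk, f.map_smul, smul_add]
  · have hmono : ∀ {x y : P}, CLe x y → CLe (k x) (k y) := by
      rintro x _ ⟨z, rfl⟩
      refine ⟨k z, add_cancel_left (c := f (x + z)) ?_⟩
      rw [hk, g.map_add, ← hk, ← hk, f.map_add]; abel
    refine ⟨fun n => hmono (ha.le n), fun b hb => ?_⟩
    refine CLe.of_add_left (c := f a) ?_
    change CLe (f a + k a) _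
    rw [hk]
    refine (g.isSup hs ha).least _ fun n => ?_
    rw [← hk]
    exact ((f.isSup hs ha).le n).add (hb n)

theorem exists_pointwise_sup [CompleteCone P] [CompleteCone Q] {s : ℕ → ContLin P Q}
    (h1 : ∀ n, nrm (s n) ≤ 1) (hs : ∀ n a, CLe (s n a) (s (n + 1) a)) :
    ∃ f : ContLin P Q, (∀ a, IsSup (fun n => s n a) (f a)) ∧ nrm f ≤ 1 := by
  have hb : ∀ a n, nrm (s n a) ≤ nrm a := fun a n =>
    (nrm_apply_le (s n) a).trans (mul_le_of_le_one_left zero_le (h1 n))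
  choose f hf hfn using fun a => exists_sup_of_bdd (hb a) fun n => hs n a
  refine ⟨⟨⟨⟨f, fun a b => ?_⟩, fun c a => ?_⟩, fun t a ht ha => ?_⟩, hf,
    opNrm_le _ fun a ha => (hfn a).trans ha⟩
  · refine (hf (a + b)).unique ?_
    simp only [ContLin.map_add]
    exact IsSup.add (fun n => hs n a) (fun n => hs n b) (hf a) (hf b)
  · refine (hf (c • a)).unique ?_
    simp only [ContLin.map_smul]
    exact (hf a).smul c
  · refine ⟨fun m => (hf (t m)).least _ fun n =>
      (((s n).isSup ht ha).le m).trans ((hf a).le n), fun b hb => ?_⟩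
    exact (hf a).least _ fun n => ((s n).isSup ht ha).least _ fun m =>
      ((hf (t m)).le n).trans (hb m)

theorem isSup_of_pointwise [CompleteCone P] {s : ℕ → ContLin P Q} {f : ContLin P Q}
    (h : ∀ a, IsSup (fun n => s n a) (f a)) : IsSup s f :=
  ⟨fun n => cle_of_pointwise fun a => (h a).le n, fun g hg =>
    cle_of_pointwise fun a => (h a).least _ fun n => by
      obtain ⟨k, hk⟩ := hg n; exact ⟨k a, by rw [← hk]; rfl⟩⟩

theorem CLe.apply [CompleteCone P] {f g : ContLin P Q} (h : CLe f g) (a : P) :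
    CLe (f a) (g a) := by
  obtain ⟨k, rfl⟩ := h; exact ⟨k a, rfl⟩

theorem IsSup.apply [CompleteCone P] [CompleteCone Q] {s : ℕ → ContLin P Q} {f : ContLin P Q}
    (hs : BallChain s) (h : IsSup s f) (a : P) : IsSup (fun n => s n a) (f a) := by
  obtain ⟨g, hg, -⟩ := exists_pointwise_sup hs.nrm_le fun n a => (hs.mono n).apply a
  rw [h.unique (isSup_of_pointwise hg)]; exact hg a

instance [CompleteCone P] [CompleteCone Q] : CompleteCone (ContLin P Q) where
  exists_sup s hs := by
    obtain ⟨g, hg, hg1⟩ := exists_pointwise_sup hs.nrm_le fun n a => (hs.mono n).apply a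
    exact ⟨g, isSup_of_pointwise hg, hg1⟩

/-- The identity map. -/
def ContLin.id (P : Type u) [PosCone P] : ContLin P P := ⟨LinearMap.id, fun _ _ _ h => h⟩

/-- A continuous linear map commutes with bounded suprema, not only those of the unit ball. -/
theorem ContLin.isSup_of_bdd [CompleteCone P] (f : ContLin P Q) {s : ℕ → P} {a : P} {c : ℝ≥0}
    (hc : ∀ n, nrm (s n) ≤ c) (hs : ∀ n, CLe (s n) (s (n + 1))) (h : IsSup s a) :
    IsSup (fun n => f (s n)) (f a) := by
  have h0 : c + 1 ≠ 0 := by positivity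
  have := (f.isSup (s := fun n => (c + 1)⁻¹ • s n) ⟨fun n => by
    rw [nrm_smul]
    calc (c + 1)⁻¹ * nrm (s n) ≤ (c + 1)⁻¹ * (c + 1) :=
          mul_le_mul_right ((hc n).trans le_self_add) _
      _ = 1 := inv_mul_cancel₀ h0,
    fun n => (hs n).smul _⟩ (h.smul _)).smul (c + 1)
  simpa [ContLin.map_smul, smul_smul, mul_inv_cancel₀ h0] using this

/-- Composition of continuous linear maps. -/
def ContLin.comp [CompleteCone P] [CompleteCone Q] (g : ContLin Q S) (f : ContLin P Q) :
    ContLin P S :=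
  ⟨g.toLinearMap ∘ₗ f.toLinearMap, fun _ _ hs h =>
    g.isSup_of_bdd (fun n => le_opNrm f (hs.nrm_le n)) (hs.map_mono f) (f.isSup hs h)⟩

@[simp] theorem ContLin.id_apply (a : P) : ContLin.id P a = a := rfl
@[simp] theorem ContLin.comp_apply [CompleteCone P] [CompleteCone Q] (g : ContLin Q S)
    (f : ContLin P Q) (a : P) : g.comp f a = g (f a) := rfl

/-- Evaluation at a point, as a continuous linear map on a function cone. -/
def evalAt [CompleteCone P] [CompleteCone Q] (a : P) : ContLin (ContLin P Q) Q :=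
  ⟨{ toFun := fun f => f a, map_add' := fun _ _ => rfl, map_smul' := fun _ _ => rfl },
    fun _ _ hs h => h.apply hs a⟩

/-- Continuous linear forms separate the points of the cone. -/
class SeparatedCone (P : Type u) [PosCone P] : Prop where
  sep : ∀ a b : P, (∀ f : Dual P, f a = f b) → a = b

instance : SeparatedCone ℝ≥0 where
  sep _ _ h := h (ContLin.id ℝ≥0)

instance [CompleteCone P] [CompleteCone Q] [SeparatedCone Q] : SeparatedCone (ContLin P Q) where
  sep _ _ h := ContLin.ext fun a => SeparatedCone.sep _ _ fun l => h (l.comp (evalAt a))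

end function_cone

/-! ### The category of separated complete cones -/

/-- Separated complete positive cones. -/
structure SCone : Type (u + 1) where
  carrier : Type u
  [cone : PosCone carrier]
  [complete : CompleteCone carrier]
  [separated : SeparatedCone carrier]

namespace SCone

instance : CoeSort SCone.{u} (Type u) := ⟨carrier⟩

attribute [instance] cone complete separated

/-- Morphisms: continuous linear maps that send the unit ball to the unit ball. -/
@[ext] structure Hom (P Q : SCone.{u}) where
  lin : ContLin P Q
  ball : ∀ a : P, nrm a ≤ 1 → nrm (lin a) ≤ 1

instance : Category SCone.{u} where
  Hom := Hom
  id P := ⟨ContLin.id P, fun _ h => h⟩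
  comp f g := ⟨g.lin.comp f.lin, fun a h => g.ball _ (f.ball a h)⟩

instance {P Q : SCone.{u}} : CoeFun (P ⟶ Q) (fun _ => P → Q) := ⟨fun f => f.lin⟩

theorem hom_ext {P Q : SCone.{u}} {f g : P ⟶ Q} (h : ∀ a, f a = g a) : f = g :=
  Hom.ext (ContLin.ext h)

/-- The cone of continuous linear maps, as an object of the category. -/
def limplObj (P Q : SCone.{u}) : SCone.{u} := ⟨ContLin P Q⟩

/-- `h ↦ g ∘ h ∘ f`. -/
def limplMap {P P' Q Q' : SCone.{u}} (f : P' ⟶ P) (g : Q ⟶ Q') :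
    limplObj P Q ⟶ limplObj P' Q' where
  lin :=
    ⟨{ toFun := fun h => (g.lin.comp h).comp f.lin
       map_add' := fun _ _ => ContLin.ext fun _ => g.lin.map_add _ _
       map_smul' := fun _ _ => ContLin.ext fun _ => g.lin.map_smul _ _ },
      fun s _ hs hh => isSup_of_pointwise fun a =>
        g.lin.isSup_of_bdd (c := nrm (f a))
          (fun n => (nrm_apply_le (s n) _).trans (mul_le_of_le_one_left zero_le (hs.nrm_le n)))
          (fun n => (hs.mono n).apply _) (hh.apply hs _)⟩
  ball h hh := opNrm_le _ fun a ha => g.ball _ ((le_opNrm h (f.ball a ha)).trans hh)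

/-- The bifunctor of linear function spaces. -/
def limpl : SCone.{u}ᵒᵖ ⥤ SCone.{u} ⥤ SCone.{u} where
  obj P :=
    { obj := fun Q => limplObj P.unop Q
      map := fun g => limplMap (𝟙 P.unop) g }
  map f := { app := fun Q => limplMap f.unop (𝟙 Q) }

end SCone

instance : PosCone (ULift.{u} ℝ≥0) where
  nrm a := a.down
  eq_zero_of_nrm _ h := ULift.ext _ _ h
  nrm_smul _ _ := rfl
  nrm_add_le _ _ := le_rfl
  nrm_le_add _ _ := le_self_add
  add_cancel _ _ _ h := ULift.ext _ _ (add_right_cancel (congrArg ULift.down h))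

theorem isSup_ulift_iff {s : ℕ → ULift.{u} ℝ≥0} {a : ULift.{u} ℝ≥0} :
    IsSup s a ↔ IsSup (fun n => (s n).down) a.down := by
  have hle : ∀ a b : ULift.{u} ℝ≥0, CLe a b ↔ CLe a.down b.down := fun a b =>
    ⟨by rintro ⟨c, rfl⟩; exact ⟨c.down, rfl⟩, fun ⟨c, h⟩ => ⟨⟨c⟩, ULift.ext _ _ h⟩⟩
  exact ⟨fun h => ⟨fun n => (hle _ _).1 (h.le n), fun b hb => (hle _ ⟨b⟩).1
      (h.least _ fun n => (hle _ _).2 (hb n))⟩,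
    fun h => ⟨fun n => (hle _ _).2 (h.le n), fun b hb => (hle _ _).2
      (h.least _ fun n => (hle _ _).1 (hb n))⟩⟩

/-- The identity of `ℝ≥0`, as a continuous linear form on its copy in the universe `u`. -/
def downForm : Dual (ULift.{u} ℝ≥0) :=
  ⟨{ toFun := ULift.down, map_add' := fun _ _ => rfl, map_smul' := fun _ _ => rfl },
    fun _ _ _ h => isSup_ulift_iff.1 h⟩

instance : CompleteCone (ULift.{u} ℝ≥0) where
  exists_sup s hs := by
    obtain ⟨a, ha, ha1⟩ := CompleteCone.exists_sup (fun n => (s n).down)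
      ⟨hs.nrm_le, fun n => by obtain ⟨c, hc⟩ := hs.mono n; exact ⟨c.down, by rw [← hc]; rfl⟩⟩
    exact ⟨⟨a⟩, isSup_ulift_iff.2 ha, ha1⟩

instance : SeparatedCone (ULift.{u} ℝ≥0) where
  sep _ _ h := ULift.ext _ _ (h downForm)

/-- The cone `ℝ≥0`. -/
def SCone.one : SCone.{u} := ⟨ULift.{u} ℝ≥0⟩

/-- A tensor product of cones: a bifunctor such that `- ⊗ Q` is left adjoint to `Q ⊸ -`, through
a bijection natural in the three parameters. It is unique up to natural isomorphism. -/
structure ConeTensor where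
  tensor : SCone.{u} × SCone.{u} ⥤ SCone.{u}
  curry : ∀ P Q R : SCone.{u}, (tensor.obj (P, Q) ⟶ R) ≃ (P ⟶ (SCone.limpl.obj (.op Q)).obj R)
  curry_natural : ∀ {P P' Q Q' R R' : SCone.{u}} (f : P' ⟶ P) (g : Q' ⟶ Q) (h : R ⟶ R')
    (k : tensor.obj (P, Q) ⟶ R),
    curry P' Q' R' (tensor.map (Prod.mkHom f g) ≫ k ≫ h) =
      f ≫ curry P Q R k ≫ (SCone.limpl.obj (.op Q)).map h ≫ (SCone.limpl.map g.op).app R'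

/-- Application of an element of a function cone. -/
def SCone.app {P Q : SCone.{u}} (f : SCone.limplObj P Q) (a : P) : Q :=
  (show ContLin P Q from f) a

/-- The pure tensor `a ⊗ b`: the image of `(a, b)` by the universal bilinear map. -/
def ConeTensor.tmul (T : ConeTensor.{u}) {P Q : SCone.{u}} (a : P) (b : Q) :
    (T.tensor.obj (P, Q) : SCone.{u}) :=
  SCone.app (T.curry P Q _ (𝟙 _) a) b

/-! ### Measurable cones -/

section measurability

variable {R : Type w} [Category.{x} R]

/-- A measurable cone over the reference functor `F`: a cone with, for each object `p`, a set of
measurability tests of arity `p`, closed under precomposition by the morphisms of `R`. -/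
structure MCone (F : R ⥤ MeasCat.{v}) where
  cone : SCone.{u}
  tests : ∀ p : R, Set (F.obj p → Dual cone)
  meas : ∀ (p : R) (l : F.obj p → Dual cone), l ∈ tests p → ∀ a : cone, Measurable fun r => l r a
  precomp : ∀ (p q : R) (h : q ⟶ p) (l : F.obj p → Dual cone), l ∈ tests p →
    (fun s => l (F.map h s)) ∈ tests q

namespace MCone

variable {F : R ⥤ MeasCat.{v}}

/-- Measurable paths of arity `p`. -/
structure IsPath (P : MCone.{u} F) (p : R) (γ : F.obj p → P.cone) : Prop where
  ball : ∀ r, nrm (γ r) ≤ 1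
  meas : ∀ (q : R), ∀ m ∈ P.tests q, Measurable fun rs : F.obj p × F.obj q => m rs.2 (γ rs.1)

/-- A morphism of cones is measurable if it sends measurable paths to measurable paths. -/
def IsMeas (P Q : MCone.{u} F) (f : P.cone ⟶ Q.cone) : Prop :=
  ∀ (p : R) (γ : F.obj p → P.cone), P.IsPath p γ → Q.IsPath p fun r => f (γ r)

@[ext] structure Hom (P Q : MCone.{u} F) where
  hom : P.cone ⟶ Q.cone
  isMeas : IsMeas P Q hom

/-- The category of measurable cones and measurable linear maps. -/
instance : Category (MCone.{u} F) where
  Hom := Hom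
  id P := ⟨𝟙 P.cone, fun _ _ h => h⟩
  comp f g := ⟨f.hom ≫ g.hom, fun p γ h => g.isMeas p _ (f.isMeas p γ h)⟩

instance {P Q : MCone.{u} F} : CoeFun (P ⟶ Q) (fun _ => P.cone → Q.cone) := ⟨fun f => f.hom.lin⟩

theorem hom_ext {P Q : MCone.{u} F} {f g : P ⟶ Q} (h : ∀ a, f a = g a) : f = g :=
  Hom.ext (SCone.hom_ext h)

variable (F) in
/-- The measurable cone `ℝ≥0`, whose measurability tests are constantly equal to the identity. -/
def one : MCone.{u} F where
  cone := SCone.one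
  tests _ := {fun _ => downForm}
  meas := by rintro p _ rfl a; exact measurable_const
  precomp := by rintro p q h _ rfl; rfl

/-! #### Measurable function spaces -/

variable {P Q P' Q' S : MCone.{u} F}

/-- Maps `f` such that `c • f` is a measurable morphism of cones for some `c > 0`. -/
def IsMeasLin (f : ContLin P.cone Q.cone) : Prop :=
  ∃ (c : ℝ≥0) (h : ∀ a, nrm a ≤ 1 → nrm ((c • f) a) ≤ 1), 0 < c ∧ IsMeas P Q ⟨c • f, h⟩

theorem isMeasLin_iff (f : ContLin P.cone Q.cone) :
    IsMeasLin f ↔ ∀ (p : R) (γ : F.obj p → P.cone), P.IsPath p γ → ∀ (q : R), ∀ m ∈ Q.tests q,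
      Measurable fun rs : F.obj p × F.obj q => m rs.2 (f (γ rs.1)) := by
  constructor
  · rintro ⟨c, h, hc, hm⟩ p γ hγ q m hmq
    have := ((hm p γ hγ).meas q m hmq).const_mul c⁻¹
    convert this using 2 with rs
    change _ = c⁻¹ * m rs.2 (c • f (γ rs.1))
    rw [ContLin.map_smul, smul_eq_mul, ← mul_assoc, inv_mul_cancel₀ hc.ne', one_mul]
  · intro H
    have h0 : nrm f + 1 ≠ 0 := by positivity
    have hb : ∀ a, nrm a ≤ 1 → nrm (((nrm f + 1)⁻¹ • f) a) ≤ 1 := fun a ha => by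
      rw [ContLin.smul_apply, nrm_smul]
      calc (nrm f + 1)⁻¹ * nrm (f a) ≤ (nrm f + 1)⁻¹ * (nrm f + 1) :=
            mul_le_mul_right ((le_opNrm f ha).trans le_self_add) _
        _ = 1 := inv_mul_cancel₀ h0
    refine ⟨(nrm f + 1)⁻¹, hb, by positivity, fun p γ hγ => ⟨fun r => hb _ (hγ.ball r), ?_⟩⟩
    intro q m hm
    have := (H p γ hγ q m hm).const_mul (nrm f + 1)⁻¹
    convert this using 2 with rs
    change m rs.2 ((nrm f + 1)⁻¹ • f (γ rs.1)) = _
    rw [ContLin.map_smul, smul_eq_mul]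

variable (P Q) in
/-- The subcone of the continuous linear maps that are measurable up to a scalar. -/
def measLin : Submodule ℝ≥0 (ContLin P.cone Q.cone) where
  carrier := {f | IsMeasLin f}
  zero_mem' := (isMeasLin_iff _).2 fun p γ _ q m _ => by
    simp [ContLin.map_zero]
  add_mem' {f g} hf hg := (isMeasLin_iff _).2 fun p γ hγ q m hm => by
    simp only [ContLin.add_apply, ContLin.map_add]
    exact ((isMeasLin_iff f).1 hf p γ hγ q m hm).add ((isMeasLin_iff g).1 hg p γ hγ q m hm)
  smul_mem' c f hf := (isMeasLin_iff _).2 fun p γ hγ q m hm => by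
    simp only [ContLin.smul_apply, ContLin.map_smul, smul_eq_mul]
    exact ((isMeasLin_iff f).1 hf p γ hγ q m hm).const_mul c

theorem measLin_meas (f : measLin P Q) {p : R} {γ : F.obj p → P.cone} (hγ : P.IsPath p γ)
    {q : R} {m : F.obj q → Dual Q.cone} (hm : m ∈ Q.tests q) :
    Measurable fun rs : F.obj p × F.obj q => m rs.2 (f.1 (γ rs.1)) :=
  (isMeasLin_iff f.1).1 f.2 p γ hγ q m hm

/-- The norm of `measLin P Q` is induced by that of the cone of continuous linear maps. -/
instance : PosCone (measLin P Q) where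
  nrm f := nrm f.1
  eq_zero_of_nrm f h := Subtype.ext (eq_zero_of_nrm f.1 h)
  nrm_smul c f := nrm_smul c f.1
  nrm_add_le f g := nrm_add_le f.1 g.1
  nrm_le_add f g := nrm_le_add f.1 g.1
  add_cancel f g h e := Subtype.ext (add_cancel f.1 g.1 h.1 (congrArg Subtype.val e))

theorem measLin_cle_iff {f g : measLin P Q} : CLe f g ↔ CLe f.1 g.1 := by
  constructor
  · rintro ⟨k, rfl⟩; exact ⟨k.1, rfl⟩
  · rintro ⟨k, hk⟩
    refine ⟨⟨k, (isMeasLin_iff k).2 fun p γ hγ q m hm => ?_⟩, Subtype.ext hk⟩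
    have := (measLin_meas g hγ hm).sub (measLin_meas f hγ hm)
    convert this using 2 with rs
    change _ = m rs.2 (g.1 (γ rs.1)) - m rs.2 (f.1 (γ rs.1))
    rw [← hk, ContLin.add_apply, ContLin.map_add, add_tsub_cancel_left]

theorem measLin_chain {s : ℕ → measLin P Q} (hs : BallChain s) : BallChain fun n => (s n).1 :=
  ⟨hs.nrm_le, fun n => measLin_cle_iff.1 (hs.mono n)⟩

theorem exists_measLin_sup {s : ℕ → measLin P Q} (hs : BallChain s) :
    ∃ f : measLin P Q, IsSup (fun n => (s n).1) f.1 ∧ nrm f ≤ 1 := by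
  have hs' := measLin_chain hs
  obtain ⟨f, hf, hf1⟩ := CompleteCone.exists_sup _ hs'
  refine ⟨⟨f, (isMeasLin_iff f).2 fun p γ hγ q m hm => ?_⟩, hf, hf1⟩
  refine Measurable.isLUB (fun n => measLin_meas (s n) hγ hm) fun rs => ?_
  refine isSup_nnreal_iff.1 (ContLin.isSup_of_bdd (m rs.2) (c := 1) (fun n => ?_)
    (fun n => (hs'.mono n).apply _) (hf.apply hs' _))
  exact (le_opNrm _ (hγ.ball _)).trans (hs'.nrm_le n)

theorem measLin_isSup {s : ℕ → measLin P Q} {f : measLin P Q} (hs : BallChain s)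
    (h : IsSup s f) : IsSup (fun n => (s n).1) f.1 := by
  obtain ⟨g, hg, -⟩ := exists_measLin_sup hs
  have : IsSup s g := ⟨fun n => measLin_cle_iff.2 (hg.le n), fun b hb => measLin_cle_iff.2
    (hg.least _ fun n => measLin_cle_iff.1 (hb n))⟩
  rw [h.unique this]; exact hg

theorem measLin_isSup_of {s : ℕ → measLin P Q} {f : measLin P Q}
    (h : IsSup (fun n => (s n).1) f.1) : IsSup s f :=
  ⟨fun n => measLin_cle_iff.2 (h.le n), fun _ hb => measLin_cle_iff.2
    (h.least _ fun n => measLin_cle_iff.1 (hb n))⟩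

instance : CompleteCone (measLin P Q) where
  exists_sup s hs := by
    obtain ⟨g, hg, hg1⟩ := exists_measLin_sup hs
    exact ⟨g, measLin_isSup_of hg, hg1⟩

/-- The inclusion in the cone of all continuous linear maps. -/
def inclMeasLin : ContLin (measLin P Q) (ContLin P.cone Q.cone) :=
  ⟨(measLin P Q).subtype, fun _ _ hs h => measLin_isSup hs h⟩

instance : SeparatedCone (measLin P Q) where
  sep _ _ h := Subtype.ext (SeparatedCone.sep _ _ fun l => h (l.comp inclMeasLin))

/-- The form `f ↦ l (f a)`. -/
def pairing (a : P.cone) (l : Dual Q.cone) : Dual (measLin P Q) :=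
  l.comp ((evalAt a).comp inclMeasLin)

@[simp] theorem pairing_apply (a : P.cone) (l : Dual Q.cone) (f : measLin P Q) :
    pairing a l f = l (f.1 a) := rfl

theorem IsPath.precomp {p q : R} (h : q ⟶ p) {γ : F.obj p → P.cone} (hγ : P.IsPath p γ) :
    P.IsPath q fun s => γ (F.map h s) :=
  ⟨fun _ => hγ.ball _, fun k m hm => (hγ.meas k m hm).comp
    (((F.map h).2.comp measurable_fst).prodMk measurable_snd)⟩

/-- The measurable cone `P ⊸ Q`. -/
def limplmObj (P Q : MCone.{u} F) : MCone.{u} F where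
  cone := ⟨measLin P Q⟩
  tests p := {t | ∃ γ l, P.IsPath p γ ∧ l ∈ Q.tests p ∧ t = fun r => pairing (γ r) (l r)}
  meas := by
    rintro p _ ⟨γ, l, hγ, hl, rfl⟩ f
    exact (measLin_meas f hγ hl).comp (measurable_id.prodMk measurable_id)
  precomp := by
    rintro p q h _ ⟨γ, l, hγ, hl, rfl⟩
    exact ⟨_, _, hγ.precomp h, Q.precomp p q h l hl, rfl⟩

/-- Application of an element of a measurable function space. -/
def app (f : (limplmObj P Q).cone) (a : P.cone) : Q.cone := (show measLin P Q from f).1 a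

section functoriality

variable [HasFiniteProducts R] [PreservesFiniteProducts F]

/-- The canonical map `F.obj (p ⨯ q) → F.obj p × F.obj q` has a measurable section. -/
theorem exists_pairing (p q : R) : ∃ φ : F.obj p × F.obj q → F.obj (p ⨯ q), Measurable φ ∧
    ∀ rs, F.map prod.fst (φ rs) = rs.1 ∧ F.map prod.snd (φ rs) = rs.2 := by
  have hl := mapIsLimitOfPreservesOfIsLimit F prod.fst prod.snd (prodIsProd p q)
  let a : MeasCat.of (F.obj p × F.obj q) ⟶ F.obj p := ⟨Prod.fst, measurable_fst⟩
  let b : MeasCat.of (F.obj p × F.obj q) ⟶ F.obj q := ⟨Prod.snd, measurable_snd⟩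
  let φ := hl.lift (BinaryFan.mk a b)
  have h1 : φ ≫ F.map prod.fst = a := hl.fac (BinaryFan.mk a b) ⟨WalkingPair.left⟩
  have h2 : φ ≫ F.map prod.snd = b := hl.fac (BinaryFan.mk a b) ⟨WalkingPair.right⟩
  exact ⟨φ.1, φ.2, fun rs => ⟨congrFun (congrArg Subtype.val h1) rs,
    congrFun (congrArg Subtype.val h2) rs⟩⟩

/-- Evaluating a measurable path of functions on a measurable path of arguments. -/
theorem IsPath.eval {p q : R} {θ : F.obj p → (limplmObj P Q).cone} {γ : F.obj q → P.cone}
    (hθ : (limplmObj P Q).IsPath p θ) (hγ : P.IsPath q γ) :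
    Q.IsPath (p ⨯ q) fun t => app (θ (F.map prod.fst t)) (γ (F.map prod.snd t)) := by
  refine ⟨fun t => (le_opNrm _ (hγ.ball _)).trans (hθ.ball _), fun k m hm => ?_⟩
  obtain ⟨φ, hφ, hφ'⟩ := exists_pairing (F := F) q k
  have := hθ.meas (q ⨯ k) (fun t => pairing (γ (F.map prod.fst t)) (m (F.map prod.snd t)))
    ⟨_, _, hγ.precomp prod.fst, Q.precomp k (q ⨯ k) prod.snd m hm, rfl⟩
  have hψ : Measurable fun x : F.obj (p ⨯ q) × F.obj k =>
      ((F.map prod.fst x.1 : F.obj p), φ ((F.map prod.snd x.1 : F.obj q), x.2)) :=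
    ((F.map prod.fst).2.comp measurable_fst).prodMk
      (hφ.comp (((F.map prod.snd).2.comp measurable_fst).prodMk measurable_snd))
  convert this.comp hψ using 2 with x
  simp only [Function.comp, (hφ' _).1, (hφ' _).2]
  rfl

/-- `h ↦ g ∘ h ∘ f`. -/
def limplmMap (f : P' ⟶ P) (g : Q ⟶ Q') : limplmObj P Q ⟶ limplmObj P' Q' where
  hom :=
    { lin :=
        ⟨{ toFun := fun h => (⟨(SCone.limplMap f.hom g.hom).lin h.1, by
              obtain ⟨c, hb, hc, hm⟩ := h.2
              have e : ∀ a, g.hom.lin ((c • h.1) (f.hom.lin a)) =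
                  (c • (g.hom.lin.comp h.1).comp f.hom.lin) a :=
                fun a => g.hom.lin.map_smul c _
              refine ⟨c, fun a ha => ?_, hc, fun p γ hγ => ?_⟩
              · refine (congrArg nrm (e a)).symm.le.trans ?_
                exact g.hom.ball _ (hb _ (f.hom.ball a ha))
              · have := g.isMeas p _ (hm p _ (f.isMeas p γ hγ))
                convert this using 2 with r
                exact (e _).symm⟩ : measLin P' Q')
           map_add' := fun h k => Subtype.ext ((SCone.limplMap f.hom g.hom).lin.map_add h.1 k.1)
           map_smul' := fun c h =>
            Subtype.ext ((SCone.limplMap f.hom g.hom).lin.map_smul c h.1) },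
          fun s h hs hh => measLin_isSup_of ((SCone.limplMap f.hom g.hom).lin.isSup
            (measLin_chain hs) (measLin_isSup hs hh))⟩
      ball := fun h hh => (SCone.limplMap f.hom g.hom).ball h.1 hh }
  isMeas p θ hθ := by
    refine ⟨fun r => (SCone.limplMap f.hom g.hom).ball (θ r).1 (hθ.ball r), ?_⟩
    rintro q _ ⟨γ, l, hγ, hl, rfl⟩
    obtain ⟨φ, hφ, hφ'⟩ := exists_pairing (F := F) p q
    have := ((g.isMeas _ _ (hθ.eval (f.isMeas q γ hγ))).meas q l hl).comp
      (hφ.prodMk measurable_snd)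
    convert this using 2 with rs
    simp only [Function.comp, (hφ' _).1, (hφ' _).2]
    rfl

/-- The bifunctor of measurable linear function spaces. -/
def limplm : (MCone.{u} F)ᵒᵖ ⥤ MCone.{u} F ⥤ MCone.{u} F where
  obj P :=
    { obj := fun Q => limplmObj P.unop Q
      map := fun g => limplmMap (𝟙 P.unop) g }
  map f := { app := fun Q => limplmMap f.unop (𝟙 Q) }

end functoriality

end MCone

/-! #### Tensor products of measurable cones -/

namespace ConeTensor

variable {F : R ⥤ MeasCat.{v}} (T : ConeTensor.{u})

/-- The measurable cone `P ⊗ Q`. -/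
def mobj (P Q : MCone.{u} F) : MCone.{u} F where
  cone := T.tensor.obj (P.cone, Q.cone)
  tests k := {m | (∀ z, Measurable fun w => m w z) ∧
    ∀ (p q : R) (γ : F.obj p → P.cone) (δ : F.obj q → Q.cone), P.IsPath p γ → Q.IsPath q δ →
      Measurable fun x : F.obj p × F.obj q × F.obj k => m x.2.2 (T.tmul (γ x.1) (δ x.2.1))}
  meas _ _ hm := hm.1
  precomp _ _ h _ hm :=
    ⟨fun z => (hm.1 z).comp (F.map h).2, fun p q γ δ hγ hδ => (hm.2 p q γ δ hγ hδ).comp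
      (measurable_fst.prodMk ((measurable_fst.comp measurable_snd).prodMk
        ((F.map h).2.comp (measurable_snd.comp measurable_snd))))⟩

variable (F) in
/-- The tensor product of two measurable morphisms is always measurable. -/
def Restricts : Prop :=
  ∀ {P P' Q Q' : MCone.{u} F} (f : P ⟶ P') (g : Q ⟶ Q'),
    MCone.IsMeas (T.mobj P Q) (T.mobj P' Q') (T.tensor.map (Prod.mkHom f.hom g.hom))

/-- The restriction of the tensor product to measurable cones. -/
def mfunctor (hT : T.Restricts F) : MCone.{u} F × MCone.{u} F ⥤ MCone.{u} F where
  obj X := T.mobj X.1 X.2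
  map f := ⟨T.tensor.map (Prod.mkHom f.1.hom f.2.hom), hT f.1 f.2⟩
  map_id X := MCone.Hom.ext (T.tensor.map_id (X.1.cone, X.2.cone))
  map_comp f g := MCone.Hom.ext
    (T.tensor.map_comp (Prod.mkHom f.1.hom f.2.hom) (Prod.mkHom g.1.hom g.2.hom))

end ConeTensor

end measurability

/-! ### Symmetric monoidal structures with a given tensor product and unit -/

open CategoryTheory.Prod in
/-- The remaining data and the laws of a symmetric monoidal category with tensor product `T` and
unit `I`. -/
structure SymmetricMonoidalStructure {C : Type w} [Category.{x} C] (T : C × C ⥤ C) (I : C) where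
  assoc : ∀ X Y Z : C, T.obj (T.obj (X, Y), Z) ≅ T.obj (X, T.obj (Y, Z))
  leftUnitor : ∀ X : C, T.obj (I, X) ≅ X
  rightUnitor : ∀ X : C, T.obj (X, I) ≅ X
  braiding : ∀ X Y : C, T.obj (X, Y) ≅ T.obj (Y, X)
  assoc_natural : ∀ {X X' Y Y' Z Z' : C} (f : X ⟶ X') (g : Y ⟶ Y') (h : Z ⟶ Z'),
    T.map (T.map (f ×ₘ g) ×ₘ h) ≫ (assoc X' Y' Z').hom =
      (assoc X Y Z).hom ≫ T.map (f ×ₘ T.map (g ×ₘ h))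
  leftUnitor_natural : ∀ {X X' : C} (f : X ⟶ X'),
    T.map (𝟙 I ×ₘ f) ≫ (leftUnitor X').hom = (leftUnitor X).hom ≫ f
  rightUnitor_natural : ∀ {X X' : C} (f : X ⟶ X'),
    T.map (f ×ₘ 𝟙 I) ≫ (rightUnitor X').hom = (rightUnitor X).hom ≫ f
  braiding_natural : ∀ {X X' Y Y' : C} (f : X ⟶ X') (g : Y ⟶ Y'),
    T.map (f ×ₘ g) ≫ (braiding X' Y').hom = (braiding X Y).hom ≫ T.map (g ×ₘ f)
  pentagon : ∀ W X Y Z : C,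
    T.map ((assoc W X Y).hom ×ₘ 𝟙 Z) ≫ (assoc W (T.obj (X, Y)) Z).hom ≫
        T.map (𝟙 W ×ₘ (assoc X Y Z).hom) =
      (assoc (T.obj (W, X)) Y Z).hom ≫ (assoc W X (T.obj (Y, Z))).hom
  triangle : ∀ X Y : C,
    (assoc X I Y).hom ≫ T.map (𝟙 X ×ₘ (leftUnitor Y).hom) =
      T.map ((rightUnitor X).hom ×ₘ 𝟙 Y)
  hexagon : ∀ X Y Z : C,
    (assoc X Y Z).hom ≫ (braiding X (T.obj (Y, Z))).hom ≫ (assoc Y Z X).hom =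
      T.map ((braiding X Y).hom ×ₘ 𝟙 Z) ≫ (assoc Y X Z).hom ≫
        T.map (𝟙 Y ×ₘ (braiding X Z).hom)
  symmetry : ∀ X Y : C, (braiding X Y).hom ≫ (braiding Y X).hom = 𝟙 (T.obj (X, Y))

namespace SymmetricMonoidalStructure

variable {C : Type w} [Category.{x} C] {T : C × C ⥤ C} {I : C}

open CategoryTheory.Prod

/-- The monoidal category underlying a symmetric monoidal structure. -/
abbrev toMonoidalCategory (S : SymmetricMonoidalStructure T I) : MonoidalCategory C :=
  letI : MonoidalCategoryStruct C :=
    { tensorObj := fun X Y => T.obj (X, Y)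
      whiskerLeft := fun X _ _ f => T.map (𝟙 X ×ₘ f)
      whiskerRight := fun f Y => T.map (f ×ₘ 𝟙 Y)
      tensorHom := fun f g => T.map (f ×ₘ g)
      tensorUnit := I
      associator := S.assoc
      leftUnitor := S.leftUnitor
      rightUnitor := S.rightUnitor }
  MonoidalCategory.ofTensorHom
    (id_tensorHom_id := fun X Y => T.map_id (X, Y))
    (id_tensorHom := fun _ _ _ _ => rfl)
    (tensorHom_id := fun _ _ => rfl)
    (tensorHom_comp_tensorHom := fun f g h k => (T.map_comp (f ×ₘ g) (h ×ₘ k)).symm)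
    (associator_naturality := S.assoc_natural)
    (leftUnitor_naturality := S.leftUnitor_natural)
    (rightUnitor_naturality := S.rightUnitor_natural)
    (pentagon := S.pentagon)
    (triangle := S.triangle)

/-- The symmetric monoidal category given by a symmetric monoidal structure. -/
abbrev toSymmetricCategory (S : SymmetricMonoidalStructure T I) :
    @SymmetricCategory C _ S.toMonoidalCategory :=
  letI := S.toMonoidalCategory
  letI : BraidedCategory C :=
    { braiding := S.braiding
      braiding_naturality_right := fun X _ _ f => S.braiding_natural (𝟙 X) f
      braiding_naturality_left := fun f Z => S.braiding_natural f (𝟙 Z)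
      hexagon_forward := S.hexagon
      hexagon_reverse := fun X Y Z => by
        have hb : ∀ X Y : C, (S.braiding X Y).inv = (S.braiding Y X).hom := fun X Y =>
          by rw [← cancel_epi (S.braiding X Y).hom, Iso.hom_inv_id, S.symmetry]
        have e : S.assoc Z X Y ≪≫ S.braiding Z (T.obj (X, Y)) ≪≫ S.assoc X Y Z =
            T.mapIso (Iso.prod (S.braiding Z X) (Iso.refl Y)) ≪≫ S.assoc X Z Y ≪≫
              T.mapIso (Iso.prod (Iso.refl X) (S.braiding Z Y)) := Iso.ext (S.hexagon Z X Y)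
        have e' := congrArg Iso.inv e
        simp only [Iso.trans_inv, Functor.mapIso_inv, Iso.prod_inv, Iso.refl_inv, hb,
          Category.assoc] at e'
        exact e' }
  { symmetry := S.symmetry }

end SymmetricMonoidalStructure

end Cones

end

/-! Existence. A tensor product has to represent the bilinear maps out of `P × Q` into all separated
complete cones, a proper class of targets. Since targets are separated, a value in a target is
determined by its images under the continuous forms, and these images come from bilinear forms on `P
× Q`. So an element of the tensor product may be taken to be a functional `z` on bilinear forms,
which keeps it in the universe of `P` and `Q`. The functionals kept in `evalCone` are those at which
every bilinear map `f` has a value `val f z`, with norm at most `c * nrm f` for a `c` independent of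
`f`. Order, suprema and norm are all detected by the maps `val f`, so completeness and separation
follow from those of the targets. The tensor product is the closed subcone generated by the pure
tensors, where closed means stable under existing differences and suprema: this is what makes a
continuous linear map out of it determined by its values on pure tensors.

Measurability, for an arbitrary tensor product `T`. The tests of `P ⊗ Q` are chosen as large as
possible subject to joint measurability along pairs of paths. Two facts follow. If `f` out of `P ⊗
Q` is jointly measurable on pairs of paths, then a test of the codomain composed with `f` is a test
of `P ⊗ Q`, so `f` is measurable (`isMeas_of_tmul`); conversely, the pure tensor of two paths of one
arity is a path (`IsPath.tmul`). Two arities `p` and `q` are brought to the common arity `p ⨯ q` by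
precomposition with the projections, and `exists_pairing` returns to the product of measurable
spaces because `F` preserves finite products. Together these make currying a bijection between
measurable maps, and make it measurable as a map between function spaces (`internalCurry`).

The associator is then obtained by uncurrying twice, and its inverse by conjugating with the
braiding. All coherence laws hold because maps out of iterated tensor products are determined by
iterated pure tensors, on which every structure map has an explicit formula. -/

noncomputable section

namespace Cones

open PosCone

/-! ### Closed subcones -/

section closed_hull

variable {P : Type u} {Q : Type v} [PosCone P] [PosCone Q]

/-- Subcones that are closed under the differences and the suprema that exist in the cone. -/
structure IsClosedSub (S : Submodule ℝ≥0 P) : Prop where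
  sub_mem : ∀ a b : P, a ∈ S → a + b ∈ S → b ∈ S
  sup_mem : ∀ (s : ℕ → P) (a : P), (∀ n, s n ∈ S) → BallChain s → IsSup s a → a ∈ S

/-- The closed subcone generated by a set. -/
def closedHull (X : Set P) : Submodule ℝ≥0 P := sInf {S | X ⊆ S ∧ IsClosedSub S}

theorem subset_closedHull (X : Set P) : X ⊆ closedHull X := fun a ha => by
  rw [closedHull, SetLike.mem_coe, Submodule.mem_sInf]
  exact fun S hS => hS.1 ha

theorem closedHull_le {X : Set P} {S : Submodule ℝ≥0 P} (hX : X ⊆ S) (hS : IsClosedSub S) :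
    closedHull X ≤ S := sInf_le ⟨hX, hS⟩

theorem isClosedSub_closedHull (X : Set P) : IsClosedSub (closedHull X) where
  sub_mem a b ha hab := by
    rw [closedHull, Submodule.mem_sInf] at *
    exact fun S hS => hS.2.sub_mem a b (ha S hS) (hab S hS)
  sup_mem s a hs hc h := by
    simp only [closedHull, Submodule.mem_sInf] at *
    exact fun S hS => hS.2.sup_mem s a (fun n => hs n S hS) hc h

variable {X : Set P}

instance : PosCone (closedHull X) where
  nrm a := nrm a.1
  eq_zero_of_nrm a h := Subtype.ext (eq_zero_of_nrm a.1 h)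
  nrm_smul c a := nrm_smul c a.1
  nrm_add_le a b := nrm_add_le a.1 b.1
  nrm_le_add a b := nrm_le_add a.1 b.1
  add_cancel a b c e := Subtype.ext (add_cancel a.1 b.1 c.1 (congrArg Subtype.val e))

/-- Closure under differences is used here: the complement of `a` in `b`, which a priori lives in
`P`, belongs to the hull. Hence suprema may be computed in `P`. -/
theorem closedHull_cle_iff {a b : closedHull X} : CLe a b ↔ CLe a.1 b.1 := by
  constructor
  · rintro ⟨c, rfl⟩; exact ⟨c.1, rfl⟩
  · rintro ⟨c, hc⟩
    exact ⟨⟨c, (isClosedSub_closedHull X).sub_mem a.1 c a.2 (hc ▸ b.2)⟩, Subtype.ext hc⟩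

theorem closedHull_isSup_of {s : ℕ → closedHull X} {a : closedHull X}
    (h : IsSup (fun n => (s n).1) a.1) : IsSup s a :=
  ⟨fun n => closedHull_cle_iff.2 (h.le n), fun _ hb => closedHull_cle_iff.2
    (h.least _ fun n => closedHull_cle_iff.1 (hb n))⟩

theorem closedHull_chain {s : ℕ → closedHull X} (hs : BallChain s) :
    BallChain fun n => (s n).1 := ⟨hs.nrm_le, fun n => closedHull_cle_iff.1 (hs.mono n)⟩

theorem closedHull_exists_sup [CompleteCone P] {s : ℕ → closedHull X} (hs : BallChain s) :
    ∃ a : closedHull X, IsSup (fun n => (s n).1) a.1 ∧ nrm a ≤ 1 := by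
  obtain ⟨a, ha, ha1⟩ := CompleteCone.exists_sup _ (closedHull_chain hs)
  exact ⟨⟨a, (isClosedSub_closedHull X).sup_mem _ a (fun n => (s n).2) (closedHull_chain hs) ha⟩,
    ha, ha1⟩

instance [CompleteCone P] : CompleteCone (closedHull X) where
  exists_sup _ hs := by
    obtain ⟨a, ha, ha1⟩ := closedHull_exists_sup hs
    exact ⟨a, closedHull_isSup_of ha, ha1⟩

/-- The inclusion of a closed subcone. -/
def closedHullIncl [CompleteCone P] (X : Set P) : ContLin (closedHull X) P :=
  ⟨(closedHull X).subtype, fun s a hs h => by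
    -- The supremum taken in `P` lies in the hull and is also a supremum there, so it is the given
    -- one.
    obtain ⟨b, hb, -⟩ := closedHull_exists_sup hs
    rw [h.unique (closedHull_isSup_of hb)]; exact hb⟩

instance [CompleteCone P] [SeparatedCone P] : SeparatedCone (closedHull X) where
  sep _ _ h := Subtype.ext (SeparatedCone.sep _ _ fun l => h (l.comp (closedHullIncl X)))

/-- Continuous linear maps are determined by their values on generators. -/
theorem closedHull_hom_ext {f g : ContLin (closedHull X) Q}
    (h : ∀ a (ha : a ∈ X), f ⟨a, subset_closedHull X ha⟩ = g ⟨a, subset_closedHull X ha⟩) :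
    f = g := by
  -- The equalizer of `f` and `g`, seen inside `P`. It is a closed subcone that contains the
  -- generators, so it contains the whole hull.
  let E : Submodule ℝ≥0 P :=
    { carrier := {z | ∃ hz : z ∈ closedHull X, f ⟨z, hz⟩ = g ⟨z, hz⟩}
      zero_mem' := ⟨Submodule.zero_mem _, f.map_zero.trans g.map_zero.symm⟩
      add_mem' := by
        rintro a b ⟨ha, ha'⟩ ⟨hb, hb'⟩
        refine ⟨Submodule.add_mem _ ha hb, ?_⟩
        have hf := f.map_add ⟨a, ha⟩ ⟨b, hb⟩
        have hg := g.map_add ⟨a, ha⟩ ⟨b, hb⟩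
        rw [ha', hb', ← hg] at hf
        exact hf
      smul_mem' := by
        rintro c a ⟨ha, ha'⟩
        refine ⟨Submodule.smul_mem _ c ha, ?_⟩
        have hf := f.map_smul c ⟨a, ha⟩
        rw [ha', ← g.map_smul] at hf
        exact hf }
  have hE : IsClosedSub E := by
    constructor
    · rintro a b ⟨ha, ha'⟩ ⟨hab, hab'⟩
      have hb := (isClosedSub_closedHull X).sub_mem a b ha hab
      refine ⟨hb, add_cancel_left (c := f ⟨a, ha⟩) ?_⟩
      rw [← f.map_add, ha', ← g.map_add]
      exact hab'
    · intro s a hs hc ha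
      choose hs hs' using hs
      have ha' := (isClosedSub_closedHull X).sup_mem s a hs hc ha
      refine ⟨ha', ?_⟩
      have hc' : BallChain fun n => (⟨s n, hs n⟩ : closedHull X) :=
        ⟨hc.nrm_le, fun n => closedHull_cle_iff.2 (hc.mono n)⟩
      have hsup : IsSup (fun n => (⟨s n, hs n⟩ : closedHull X)) ⟨a, ha'⟩ :=
        closedHull_isSup_of ha
      refine (f.isSup hc' hsup).unique ?_
      simp only [hs']
      exact g.isSup hc' hsup
  have hle : closedHull X ≤ E :=
    closedHull_le (fun a ha => ⟨subset_closedHull X ha, h a ha⟩) hE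
  ext a
  exact (hle a.2).2

end closed_hull

/-! ### Existence of the tensor product of cones -/

/-- Composition on the left with a continuous linear map. -/
def ContLin.postcomp {P : Type u} {Q : Type v} {S : Type w} [PosCone P] [PosCone Q] [PosCone S]
    [CompleteCone P] [CompleteCone Q] (g : ContLin Q S) :
    ContLin (ContLin P Q) (ContLin P S) :=
  ⟨{ toFun := fun h => g.comp h
     map_add' := fun _ _ => ContLin.ext fun _ => g.map_add _ _
     map_smul' := fun _ _ => ContLin.ext fun _ => g.map_smul _ _ },
    fun s _ hs hh => isSup_of_pointwise fun a =>
      g.isSup_of_bdd (c := nrm a)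
        (fun n => (nrm_apply_le (s n) _).trans (mul_le_of_le_one_left zero_le (hs.nrm_le n)))
        (fun n => (hs.mono n).apply _) (hh.apply hs _)⟩

@[simp] theorem ContLin.postcomp_apply {P : Type u} {Q : Type v} {S : Type w} [PosCone P]
    [PosCone Q] [PosCone S] [CompleteCone P] [CompleteCone Q] (g : ContLin Q S)
    (h : ContLin P Q) (a : P) : g.postcomp h a = g (h a) := rfl

/-- The isomorphism of `ℝ≥0` with its copy in the universe `u`. -/
def upMap : ContLin ℝ≥0 (ULift.{u} ℝ≥0) :=
  ⟨{ toFun := ULift.up, map_add' := fun _ _ => rfl, map_smul' := fun _ _ => rfl },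
    fun _ _ _ h => isSup_ulift_iff.2 h⟩

/-! ### Functionals on bilinear forms at which every bilinear map has a value -/

namespace TensorConstruction

variable {P Q : SCone.{u}}

/-- The bilinear forms obtained from a bilinear map by composition with the forms of its codomain. -/
def formOf {N : SCone.{u}} (f : ContLin P (ContLin Q N)) (l : Dual N) : ContLin P (Dual Q) :=
  l.postcomp.comp f

@[simp] theorem formOf_apply {N : SCone.{u}} (f : ContLin P (ContLin Q N)) (l : Dual N) (a : P)
    (b : Q) : formOf f l a b = l (f a b) := rfl

/-- `r` is the value at the functional `z` of the linear extension of the bilinear map `f`. -/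
def IsVal {N : SCone.{u}} (f : ContLin P (ContLin Q N)) (z : ContLin P (Dual Q) → ℝ≥0) (r : N) :
    Prop := ∀ l : Dual N, l r = z (formOf f l)

/-- The forms of `N` separate its points; this is where separation of the targets enters the
construction. -/
theorem IsVal.unique {N : SCone.{u}} {f : ContLin P (ContLin Q N)} {z : ContLin P (Dual Q) → ℝ≥0}
    {r s : N} (hr : IsVal f z r) (hs : IsVal f z s) : r = s :=
  SeparatedCone.sep _ _ fun l => (hr l).trans (hs l).symm

/-- The functionals on bilinear forms at which all bilinear maps can be evaluated, with a uniform
bound. -/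
def IsBdd (z : ContLin P (Dual Q) → ℝ≥0) (c : ℝ≥0) : Prop :=
  ∀ (N : SCone.{u}) (f : ContLin P (ContLin Q N)), ∃ r, IsVal f z r ∧ nrm r ≤ c * nrm f

variable (P Q) in
/-- The cone of the functionals at which all bilinear maps can be evaluated. -/
def evalCone : Submodule ℝ≥0 (ContLin P (Dual Q) → ℝ≥0) where
  carrier := {z | ∃ c, IsBdd z c}
  zero_mem' := ⟨0, fun _ f => ⟨0, fun l => l.map_zero, by rw [nrm_zero]; exact zero_le⟩⟩
  add_mem' := by
    rintro y z ⟨c, hc⟩ ⟨d, hd⟩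
    refine ⟨c + d, fun N f => ?_⟩
    obtain ⟨r, hr, hr'⟩ := hc N f
    obtain ⟨s, hs, hs'⟩ := hd N f
    refine ⟨r + s, fun l => ?_, ?_⟩
    · rw [l.map_add, hr, hs]; rfl
    · rw [add_mul]; exact (nrm_add_le _ _).trans (add_le_add hr' hs')
  smul_mem' := by
    rintro k z ⟨c, hc⟩
    refine ⟨k * c, fun N f => ?_⟩
    obtain ⟨r, hr, hr'⟩ := hc N f
    refine ⟨k • r, fun l => ?_, ?_⟩
    · rw [l.map_smul, hr]; rfl
    · rw [nrm_smul, mul_assoc]; exact mul_le_mul_right hr' k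

/-- The linear extension of a bilinear map. -/
def val {N : SCone.{u}} (f : ContLin P (ContLin Q N)) (z : evalCone P Q) : N :=
  (z.2.choose_spec N f).choose

theorem isVal_val {N : SCone.{u}} (f : ContLin P (ContLin Q N)) (z : evalCone P Q) :
    IsVal f z.1 (val f z) := (z.2.choose_spec N f).choose_spec.1

/-- The working tool for `val`: to compute a value, it is enough to check a candidate against all
forms of `N`. -/
theorem val_eq {N : SCone.{u}} {f : ContLin P (ContLin Q N)} {z : evalCone P Q} {r : N}
    (h : IsVal f z.1 r) : val f z = r := (isVal_val f z).unique h

theorem val_add {N : SCone.{u}} (f : ContLin P (ContLin Q N)) (y z : evalCone P Q) :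
    val f (y + z) = val f y + val f z :=
  val_eq fun l => by rw [l.map_add, isVal_val, isVal_val]; rfl

theorem val_smul {N : SCone.{u}} (f : ContLin P (ContLin Q N)) (c : ℝ≥0) (z : evalCone P Q) :
    val f (c • z) = c • val f z :=
  val_eq fun l => by rw [l.map_smul, isVal_val]; rfl

/-- Every bilinear form is itself a bilinear map, into the copy of `ℝ≥0` in the universe `u`, so the
values of bilinear maps recover the functional. -/
theorem val_ext {y z : evalCone P Q}
    (h : ∀ (N : SCone.{u}) (f : ContLin P (ContLin Q N)), val f y = val f z) : y = z := by
  refine Subtype.ext (funext fun β => ?_)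
  let f : ContLin P (ContLin Q SCone.one) := ContLin.comp (ContLin.postcomp upMap) β
  have hf : formOf (N := SCone.one) f downForm = β := rfl
  have hy := isVal_val (N := SCone.one) f y downForm
  have hz := isVal_val (N := SCone.one) f z downForm
  rw [hf] at hy hz
  rw [← hy, ← hz, h]

/-- The set of the bounds of a functional. -/
def bounds (z : evalCone P Q) : Set ℝ≥0 :=
  {c | ∀ (N : SCone.{u}) (f : ContLin P (ContLin Q N)), nrm (val f z) ≤ c * nrm f}

theorem bounds_nonempty (z : evalCone P Q) : (bounds z).Nonempty :=
  ⟨z.2.choose, fun N f => (z.2.choose_spec N f).choose_spec.2⟩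

/-- The infimum is attained: for `nrm f ≠ 0` the condition reads `nrm (val f z) / nrm f ≤ c`, which
passes to infima, and for `nrm f = 0` any bound already forces the value to have norm zero. -/
theorem sInf_bounds_mem (z : evalCone P Q) : sInf (bounds z) ∈ bounds z := by
  intro N f
  rcases eq_or_ne (nrm f) 0 with h0 | h0
  · obtain ⟨c, hc⟩ := bounds_nonempty z
    have := hc N f
    rw [h0, mul_zero] at *; exact this
  · rw [← div_le_iff₀ (pos_iff_ne_zero.2 h0)]
    refine le_csInf (bounds_nonempty z) fun c hc => ?_
    rw [div_le_iff₀ (pos_iff_ne_zero.2 h0)]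
    exact hc N f

theorem sInf_bounds_le {z : evalCone P Q} {c : ℝ≥0} (h : c ∈ bounds z) : sInf (bounds z) ≤ c :=
  csInf_le (OrderBot.bddBelow _) h

theorem sInf_bounds_smul_le (c : ℝ≥0) (z : evalCone P Q) :
    sInf (bounds (c • z)) ≤ c * sInf (bounds z) :=
  sInf_bounds_le fun N f => by
    rw [val_smul, nrm_smul, mul_assoc]
    exact mul_le_mul_right (sInf_bounds_mem z N f) c

instance : PosCone (evalCone P Q) where
  nrm z := sInf (bounds z)
  eq_zero_of_nrm z h := val_ext fun N f => by
    have h1 := sInf_bounds_mem z N f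
    rw [h, zero_mul] at h1
    have h2 := val_smul f 0 (0 : evalCone P Q)
    rw [zero_smul, zero_smul] at h2
    rw [h2]
    exact eq_zero_of_nrm _ (le_antisymm h1 zero_le)
  nrm_smul c z := by
    refine le_antisymm (sInf_bounds_smul_le c z) ?_
    rcases eq_or_ne c 0 with rfl | h0
    · rw [zero_mul]; exact zero_le
    · have := sInf_bounds_smul_le c⁻¹ (c • z)
      rw [smul_smul, inv_mul_cancel₀ h0, one_smul] at this
      calc c * sInf (bounds z) ≤ c * (c⁻¹ * sInf (bounds (c • z))) := mul_le_mul_right this c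
        _ = sInf (bounds (c • z)) := by rw [← mul_assoc, mul_inv_cancel₀ h0, one_mul]
  nrm_add_le y z := sInf_bounds_le fun N f => by
    rw [val_add, add_mul]
    exact (nrm_add_le _ _).trans (add_le_add (sInf_bounds_mem y N f) (sInf_bounds_mem z N f))
  nrm_le_add y z := sInf_bounds_le fun N f => by
    refine le_trans ?_ (sInf_bounds_mem (y + z) N f)
    rw [val_add]; exact nrm_le_add _ _
  add_cancel x y z e := Subtype.ext (add_right_cancel (congrArg Subtype.val e))

theorem nrm_val_le {N : SCone.{u}} (f : ContLin P (ContLin Q N)) (z : evalCone P Q) :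
    nrm (val f z) ≤ nrm z * nrm f := sInf_bounds_mem z N f

theorem nrm_le_of_val {z : evalCone P Q} {c : ℝ≥0}
    (h : ∀ (N : SCone.{u}) (f : ContLin P (ContLin Q N)), nrm (val f z) ≤ c * nrm f) :
    nrm z ≤ c := sInf_bounds_le h

theorem cle_val {N : SCone.{u}} (f : ContLin P (ContLin Q N)) {y z : evalCone P Q}
    (h : CLe y z) : CLe (val f y) (val f z) := by
  obtain ⟨d, rfl⟩ := h
  exact ⟨val f d, (val_add f y d).symm⟩

/-- The complement is the pointwise truncated difference `z - y`. At the forms obtained from `f` it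
is a genuine difference, so its value at `f` is the complement of `val f y` in `val f z`, whose norm
is at most that of `val f z`. -/
theorem cle_of_val {y z : evalCone P Q}
    (h : ∀ (N : SCone.{u}) (f : ContLin P (ContLin Q N)), CLe (val f y) (val f z)) :
    CLe y z := by
  have hd : ∀ (N : SCone.{u}) (f : ContLin P (ContLin Q N)) (d : N), val f y + d = val f z →
      IsVal f (z.1 - y.1) d := fun N f d hd l => by
    rw [Pi.sub_apply, ← isVal_val, ← isVal_val, ← hd, l.map_add, add_tsub_cancel_left]
  have hmem : z.1 - y.1 ∈ evalCone P Q := ⟨nrm z, fun N f => by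
    obtain ⟨d, h'⟩ := h N f
    refine ⟨d, hd N f d h', le_trans ?_ (nrm_val_le f z)⟩
    rw [← h', add_comm]; exact nrm_le_add _ _⟩
  refine ⟨⟨_, hmem⟩, val_ext fun N f => ?_⟩
  obtain ⟨d, h'⟩ := h N f
  rw [val_add, ← h', val_eq (z := ⟨_, hmem⟩) (hd N f d h')]

theorem isSup_of_val {s : ℕ → evalCone P Q} {z : evalCone P Q}
    (h : ∀ (N : SCone.{u}) (f : ContLin P (ContLin Q N)),
      IsSup (fun n => val f (s n)) (val f z)) : IsSup s z :=
  ⟨fun n => cle_of_val fun N f => (h N f).le n, fun _ hb => cle_of_val fun N f =>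
    (h N f).least _ fun n => cle_val f (hb n)⟩

/-- The suprema of the values are taken in each target separately. Since forms are continuous, they
are all values of one functional, the pointwise supremum of the sequence. -/
theorem exists_isSup_val {s : ℕ → evalCone P Q} (hs : BallChain s) :
    ∃ z : evalCone P Q, (∀ (N : SCone.{u}) (f : ContLin P (ContLin Q N)),
      IsSup (fun n => val f (s n)) (val f z)) ∧ nrm z ≤ 1 := by
  have hb : ∀ (N : SCone.{u}) (f : ContLin P (ContLin Q N)) (n : ℕ),
      nrm (val f (s n)) ≤ nrm f := fun N f n =>
    (nrm_val_le f (s n)).trans (mul_le_of_le_one_left zero_le (hs.nrm_le n))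
  choose r hr hr' using fun (N : SCone.{u}) (f : ContLin P (ContLin Q N)) =>
    exists_sup_of_bdd (hb N f) fun n => cle_val f (hs.mono n)
  have hv : ∀ (N : SCone.{u}) (f : ContLin P (ContLin Q N)),
      IsVal f (fun β => ⨆ n, (s n).1 β) (r N f) := fun N f l => by
    have := isSup_nnreal_iff.1
      (l.isSup_of_bdd (hb N f) (fun n => cle_val f (hs.mono n)) (hr N f))
    rw [← this.ciSup_eq]
    exact iSup_congr fun n => isVal_val f (s n) l
  let z : evalCone P Q := ⟨fun β => ⨆ n, (s n).1 β, 1, fun N f =>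
    ⟨r N f, hv N f, by rw [one_mul]; exact hr' N f⟩⟩
  have hz : ∀ (N : SCone.{u}) (f : ContLin P (ContLin Q N)), val f z = r N f :=
    fun N f => val_eq (hv N f)
  exact ⟨z, fun N f => by rw [hz]; exact hr N f,
    nrm_le_of_val fun N f => by rw [hz, one_mul]; exact hr' N f⟩

instance : CompleteCone (evalCone P Q) where
  exists_sup _ hs := by
    obtain ⟨z, hz, hz1⟩ := exists_isSup_val hs
    exact ⟨z, isSup_of_val hz, hz1⟩

/-- The linear extension of a bilinear map, as a continuous linear map. -/
def valLin {N : SCone.{u}} (f : ContLin P (ContLin Q N)) : ContLin (evalCone P Q) N :=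
  ⟨{ toFun := val f, map_add' := val_add f, map_smul' := val_smul f }, fun s a hs ha => by
    obtain ⟨z, hz, -⟩ := exists_isSup_val hs
    rw [ha.unique (isSup_of_val hz)]; exact hz N f⟩

instance : SeparatedCone (evalCone P Q) where
  sep _ _ h := val_ext fun _ f => SeparatedCone.sep _ _ fun l => h (l.comp (valLin f))

/-! ### Pure tensors and the universal property -/

/-- Pure tensors, as functionals. -/
def pure (a : P) (b : Q) : evalCone P Q :=
  ⟨fun β => β a b, nrm a * nrm b, fun N f => ⟨f a b, fun _ => rfl, by
    calc nrm (f a b) ≤ nrm (f a) * nrm b := nrm_apply_le (f a) b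
      _ ≤ (nrm f * nrm a) * nrm b := mul_le_mul_left (nrm_apply_le f a) _
      _ = nrm a * nrm b * nrm f := by ring⟩⟩

@[simp] theorem val_pure {N : SCone.{u}} (f : ContLin P (ContLin Q N)) (a : P) (b : Q) :
    val f (pure a b) = f a b := val_eq fun _ => rfl

theorem nrm_pure_le (a : P) (b : Q) : nrm (pure a b) ≤ nrm a * nrm b :=
  nrm_le_of_val fun N f => by
    rw [val_pure]
    calc nrm (f a b) ≤ nrm (f a) * nrm b := nrm_apply_le (f a) b
      _ ≤ (nrm f * nrm a) * nrm b := mul_le_mul_left (nrm_apply_le f a) _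
      _ = nrm a * nrm b * nrm f := by ring

variable (P Q) in
/-- The set of the pure tensors. -/
def pures : Set (evalCone P Q) := Set.range fun ab : P × Q => pure ab.1 ab.2

variable (P Q) in
/-- The tensor product of two cones. -/
def tensorObj : SCone.{u} := ⟨closedHull (pures P Q)⟩

/-- Pure tensors. -/
def tmk (a : P) (b : Q) : tensorObj P Q :=
  (⟨pure a b, subset_closedHull _ ⟨(a, b), rfl⟩⟩ : closedHull (pures P Q))

theorem tmk_ext {a : tensorObj P Q} {b : tensorObj P Q}
    (h : ∀ (N : SCone.{u}) (f : ContLin P (ContLin Q N)),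
      val f (show closedHull (pures P Q) from a).1 = val f (show closedHull (pures P Q) from b).1) :
    a = b := Subtype.ext (val_ext h)

theorem tmk_isSup {s : ℕ → tensorObj P Q} {z : tensorObj P Q}
    (h : ∀ (N : SCone.{u}) (f : ContLin P (ContLin Q N)),
      IsSup (fun n => val f (show closedHull (pures P Q) from s n).1)
        (val f (show closedHull (pures P Q) from z).1)) : IsSup s z :=
  closedHull_isSup_of (isSup_of_val h)

theorem val_tmk {N : SCone.{u}} (f : ContLin P (ContLin Q N)) (a : P) (b : Q) :
    val f (show closedHull (pures P Q) from tmk a b).1 = f a b := val_pure f a b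

/-- The map `b ↦ a ⊗ b`. -/
def tmkRight (a : P) : ContLin Q (tensorObj P Q) :=
  ⟨{ toFun := fun b => tmk a b
     map_add' := fun b c => tmk_ext fun N f => by
       refine (val_tmk f a (b + c)).trans ?_
       rw [(f a).map_add, ← val_tmk f, ← val_tmk f]
       exact (val_add f _ _).symm
     map_smul' := fun c b => tmk_ext fun N f => by
       refine (val_tmk f a (c • b)).trans ?_
       rw [(f a).map_smul, ← val_tmk f]
       exact (val_smul f _ _).symm },
    fun s b hs hb => tmk_isSup fun N f => by
      simp only [val_tmk]
      exact (f a).isSup hs hb⟩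

variable (P Q) in
/-- The universal bilinear map. -/
def tmkHom : P ⟶ SCone.limplObj Q (tensorObj P Q) where
  lin :=
    ⟨{ toFun := fun a => tmkRight a
       map_add' := fun a a' => ContLin.ext fun b => tmk_ext fun N f => by
         refine (val_tmk f (a + a') b).trans ?_
         rw [f.map_add, ContLin.add_apply, ← val_tmk f, ← val_tmk f]
         exact (val_add f _ _).symm
       map_smul' := fun c a => ContLin.ext fun b => tmk_ext fun N f => by
         refine (val_tmk f (c • a) b).trans ?_
         rw [f.map_smul, ContLin.smul_apply, ← val_tmk f]
         exact (val_smul f _ _).symm },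
      fun s a hs ha => isSup_of_pointwise fun b => tmk_isSup fun N f => by
        have h := f.isSup hs ha
        have e : ∀ a, val f (show closedHull (pures P Q) from tmkRight a b).1 = f a b :=
          fun a => val_tmk f a b
        simp only [e]
        exact (evalAt b).isSup_of_bdd (c := nrm f)
          (fun n => (nrm_apply_le f (s n)).trans (mul_le_of_le_one_right zero_le (hs.nrm_le n)))
          (hs.map_mono f) h⟩
  ball a ha := opNrm_le _ fun b hb => (nrm_pure_le a b).trans (mul_le_one' ha hb)

/-- The linear map on the tensor product given by a bilinear map. -/
def desc {N : SCone.{u}} (f : P ⟶ SCone.limplObj Q N) : tensorObj P Q ⟶ N where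
  lin := (valLin f.lin).comp (closedHullIncl (pures P Q))
  ball z hz := (nrm_val_le (show ContLin P (ContLin Q N) from f.lin)
    (show closedHull (pures P Q) from z).1).trans (mul_le_one' hz (opNrm_le _ f.ball))

theorem desc_tmk {N : SCone.{u}} (f : P ⟶ SCone.limplObj Q N) (a : P) (b : Q) :
    desc f (tmk a b) = SCone.app (f a) b := val_tmk (show ContLin P (ContLin Q N) from f.lin) a b

theorem tensorObj_hom_ext {N : SCone.{u}} {f g : tensorObj P Q ⟶ N}
    (h : ∀ a b, f (tmk a b) = g (tmk a b)) : f = g :=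
  SCone.Hom.ext (closedHull_hom_ext (X := pures P Q) (by rintro _ ⟨⟨a, b⟩, rfl⟩; exact h a b))

/-- The tensor product of two linear maps. -/
def tensorMap {P' Q' : SCone.{u}} (f : P ⟶ P') (g : Q ⟶ Q') : tensorObj P Q ⟶ tensorObj P' Q' :=
  desc (f ≫ tmkHom P' Q' ≫ (SCone.limpl.map g.op).app _)

theorem tensorMap_tmk {P' Q' : SCone.{u}} (f : P ⟶ P') (g : Q ⟶ Q') (a : P) (b : Q) :
    tensorMap f g (tmk a b) = tmk (f a) (g b) := desc_tmk _ a b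

/-- The tensor product of cones exists. -/
def coneTensor : ConeTensor.{u} where
  tensor :=
    { obj := fun X => tensorObj X.1 X.2
      map := fun f => tensorMap f.1 f.2
      map_id := fun X => tensorObj_hom_ext fun a b => tensorMap_tmk _ _ a b
      map_comp := fun f g => tensorObj_hom_ext fun a b => by
        refine (tensorMap_tmk _ _ a b).trans (Eq.symm ?_)
        refine (congrArg (tensorMap g.1 g.2).lin (tensorMap_tmk f.1 f.2 a b)).trans ?_
        exact tensorMap_tmk _ _ _ _ }
  curry P Q N :=
    { toFun := fun k => tmkHom P Q ≫ (SCone.limpl.obj (.op Q)).map k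
      invFun := fun f => desc f
      left_inv := fun k => tensorObj_hom_ext fun a b => desc_tmk _ a b
      right_inv := fun f => SCone.hom_ext fun a => ContLin.ext fun b => desc_tmk f a b }
  curry_natural f g h k := SCone.hom_ext fun a => ContLin.ext fun b =>
    congrArg (fun z => h (k z)) (tensorMap_tmk f g a b)

end TensorConstruction

/-! ### Scalar multiplication as a bilinear map -/

theorem isSup_smul {P : Type u} [PosCone P] [CompleteCone P] [SeparatedCone P]
    {s : ℕ → ℝ≥0} {r : ℝ≥0} (hs : ∀ n, s n ≤ 1) (hr : IsSup s r) (a : P)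
    (hm : ∀ n, CLe (s n) (s (n + 1))) : IsSup (fun n => s n • a) (r • a) := by
  have hb : ∀ n, nrm (s n • a) ≤ nrm a := fun n => by
    rw [nrm_smul]; exact mul_le_of_le_one_left zero_le (hs n)
  have hm' : ∀ n, CLe (s n • a) (s (n + 1) • a) := fun n => by
    obtain ⟨c, hc⟩ := hm n
    exact ⟨c • a, by rw [← add_smul, hc]⟩
  obtain ⟨b, hb', -⟩ := exists_sup_of_bdd hb hm'
  -- Completeness gives some supremum `b`. Every form sends it to the supremum of `s n * l a`, which
  -- is `r * l a`, so separation identifies it.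
  have e : b = r • a := SeparatedCone.sep _ _ fun l => by
    refine (l.isSup_of_bdd hb hm' hb').unique ?_
    have := hr.smul (l a)
    simp only [l.map_smul, smul_eq_mul, mul_comm _ (l a)] at this ⊢
    exact this
  rw [← e]; exact hb'

/-- The bilinear map `(r, a) ↦ r • a`. -/
def SCone.smulHom (P : SCone.{u}) : SCone.one ⟶ (SCone.limpl.obj (.op P)).obj P where
  lin :=
    ⟨{ toFun := fun r => (r.down • ContLin.id P : ContLin P P)
       map_add' := fun r s => add_smul r.down s.down (ContLin.id P)
       map_smul' := fun c r => mul_smul c r.down (ContLin.id P) },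
      fun s r hs hr => isSup_of_pointwise fun a =>
        isSup_smul (fun n => hs.nrm_le n) (isSup_ulift_iff.1 hr) a
          fun n => (hs.mono n).map downForm.toLinearMap⟩
  ball r hr := opNrm_le _ fun a ha => by
    change nrm (r.down • a) ≤ 1
    rw [nrm_smul]; exact mul_le_one' hr ha

/-! ### Measurable linear maps -/

namespace MCone

variable {R : Type w} [Category.{x} R] {F : R ⥤ MeasCat.{v}} {P Q N : MCone.{u} F}

theorem isPath_const (p : R) {a : P.cone} (ha : nrm a ≤ 1) :
    P.IsPath p fun _ => a :=
  ⟨fun _ => ha, fun k m hm => (P.meas k m hm a).comp measurable_snd⟩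

theorem Hom.measurable (f : P ⟶ N) {p : R} {γ : F.obj p → P.cone}
    (hγ : P.IsPath p γ) {k : R} {m : F.obj k → Dual N.cone} (hm : m ∈ N.tests k) :
    Measurable fun x : F.obj p × F.obj k => m x.2 (f (γ x.1)) :=
  (f.isMeas p γ hγ).meas k m hm

theorem isMeasLin_comp {g : ContLin Q.cone N.cone} {f : ContLin P.cone Q.cone}
    (hg : IsMeasLin g) (hf : IsMeasLin f) : IsMeasLin (g.comp f) := by
  obtain ⟨c, hc, hc0, hcm⟩ := hg
  obtain ⟨d, hd, hd0, hdm⟩ := hf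
  have e : ∀ a, (c • g) ((d • f) a) = ((c * d) • g.comp f) a := fun a => by
    simp only [ContLin.smul_apply, ContLin.map_smul, ContLin.comp_apply, smul_smul, mul_comm]
  refine ⟨c * d, fun a ha => ?_, mul_pos hc0 hd0, fun p γ hγ => ?_⟩
  · rw [← e]; exact hc _ (hd a ha)
  · have := hcm p _ (hdm p γ hγ)
    convert this using 2
    exact (e _).symm

/-- Restriction of the codomain to the measurable functions. -/
def codRestrict {C : Type u} [PosCone C] (f : ContLin C (ContLin Q.cone N.cone))
    (h : ∀ a, IsMeasLin (f a)) : ContLin C (measLin Q N) :=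
  ⟨{ toFun := fun a => ⟨f a, h a⟩
     map_add' := fun a b => Subtype.ext (f.map_add a b)
     map_smul' := fun c a => Subtype.ext (f.map_smul c a) },
    fun _ _ hs ha => measLin_isSup_of (f.isSup hs ha)⟩

/-- The inclusion of the measurable functions in all the continuous linear maps. -/
def inclHom (Q N : MCone.{u} F) :
    (limplmObj Q N).cone ⟶ (SCone.limpl.obj (.op Q.cone)).obj N.cone :=
  ⟨inclMeasLin, fun _ h => h⟩

theorem limplm_hom_ext {f g : P ⟶ limplmObj Q N}
    (h : ∀ a b, app (f a) b = app (g a) b) : f = g :=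
  hom_ext fun a => Subtype.ext (ContLin.ext (h a))

theorem comp_apply (f : P ⟶ Q) (g : Q ⟶ N) (a : P.cone) :
    (f ≫ g) a = g (f a) := rfl

theorem id_apply (a : P.cone) : (𝟙 P : P ⟶ P) a = a := rfl

end MCone

/-! ### The universal bilinear map of a tensor product -/

namespace ConeTensor

variable (T : ConeTensor.{u})

section cones

variable {P P' Q Q' N : SCone.{u}}

/-- The Yoneda argument: by naturality in the codomain, the curried form of `k` is that of the
identity followed by `k`. -/
theorem curry_app (k : T.tensor.obj (P, Q) ⟶ N) (a : P) (b : Q) :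
    SCone.app (T.curry P Q N k a) b = k (T.tmul a b) := by
  have h := T.curry_natural (𝟙 P) (𝟙 Q) k (𝟙 (T.tensor.obj (P, Q)))
  have e : T.tensor.map (Prod.mkHom (𝟙 P) (𝟙 Q)) ≫ 𝟙 (T.tensor.obj (P, Q)) ≫ k = k := by
    rw [Category.id_comp]
    exact (congrArg (· ≫ k) (T.tensor.map_id (P, Q))).trans (Category.id_comp k)
  rw [e] at h
  rw [h]
  rfl

/-- For an abstract `T` there is no generation by pure tensors to appeal to; the injectivity of
`curry` replaces it. -/
theorem hom_ext {f g : T.tensor.obj (P, Q) ⟶ N}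
    (h : ∀ a b, f (T.tmul a b) = g (T.tmul a b)) : f = g := by
  refine (T.curry P Q N).injective (SCone.hom_ext fun a => ContLin.ext fun b => ?_)
  exact (T.curry_app f a b).trans ((h a b).trans (T.curry_app g a b).symm)

theorem map_tmul (f : P ⟶ P') (g : Q ⟶ Q') (a : P) (b : Q) :
    T.tensor.map (Prod.mkHom f g) (T.tmul a b) = T.tmul (f a) (g b) := by
  have h := T.curry_natural f g (𝟙 _) (𝟙 (T.tensor.obj (P', Q')))
  rw [Category.comp_id, Category.comp_id] at h
  rw [← T.curry_app, h]
  rfl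

theorem symm_tmul (f : P ⟶ (SCone.limpl.obj (.op Q)).obj N) (a : P) (b : Q) :
    (T.curry P Q N).symm f (T.tmul a b) = SCone.app (f a) b := by
  rw [← T.curry_app, Equiv.apply_symm_apply]

theorem nrm_tmul_le {a : P} {b : Q} (ha : nrm a ≤ 1) (hb : nrm b ≤ 1) :
    nrm (T.tmul a b) ≤ 1 :=
  (le_opNrm (show ContLin Q (T.tensor.obj (P, Q)) from T.curry P Q _ (𝟙 _) a) hb).trans
    ((T.curry P Q _ (𝟙 _)).ball a ha)

variable (P Q) in
/-- The universal bilinear map. -/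
def tmulLin : ContLin P (ContLin Q (T.tensor.obj (P, Q))) := (T.curry P Q _ (𝟙 _)).lin

theorem tmul_add (a : P) (b c : Q) : T.tmul a (b + c) = T.tmul a b + T.tmul a c :=
  (T.tmulLin P Q a).map_add b c

theorem tmul_smul (r : ℝ≥0) (a : P) (b : Q) : T.tmul a (r • b) = r • T.tmul a b :=
  (T.tmulLin P Q a).map_smul r b

theorem smul_tmul (r : ℝ≥0) (a : P) (b : Q) : T.tmul (r • a) b = r • T.tmul a b :=
  congrArg (fun h : ContLin Q (T.tensor.obj (P, Q)) => h b) ((T.tmulLin P Q).map_smul r a)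

end cones

/-! ### The tensor product of measurable cones -/

section measurability

variable {R : Type w} [Category.{x} R] {F : R ⥤ MeasCat.{v}}
variable {P P' Q Q' N M : MCone.{u} F}

/-- A linear map on a tensor product is measurable if its restriction to pure tensors is. -/
theorem isMeas_of_tmul {f : T.tensor.obj (P.cone, Q.cone) ⟶ N.cone}
    (h : ∀ (p q k : R) (γ : F.obj p → P.cone) (δ : F.obj q → Q.cone), P.IsPath p γ →
      Q.IsPath q δ → ∀ m ∈ N.tests k,
      Measurable fun x : F.obj p × F.obj q × F.obj k => m x.2.2 (f (T.tmul (γ x.1) (δ x.2.1)))) :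
    MCone.IsMeas (T.mobj P Q) N f := fun _ _ hθ =>
  -- A test `m` of `N` composed with `f` is a test of the tensor product, by the hypothesis, so the
  -- path `θ` is measurable against it.
  ⟨fun r => f.ball _ (hθ.ball r), fun k m hm => hθ.meas k (fun w => (m w).comp f.lin)
    ⟨fun z => N.meas k m hm (f z), fun p q γ δ hγ hδ => h p q k γ δ hγ hδ m hm⟩⟩

variable (F) in
-- The condition on a test of `P' ⊗ Q'` ranges over all pairs of paths, in particular over the
-- images under `f` and `g` of paths of `P` and `Q`.
theorem restricts : T.Restricts F := fun {P P' Q Q'} f g =>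
  T.isMeas_of_tmul (N := T.mobj P' Q') fun p q k γ δ hγ hδ m hm => by
    convert hm.2 p q _ _ (f.isMeas p γ hγ) (g.isMeas q δ hδ) using 3
    exact congrArg _ (T.map_tmul f.hom g.hom _ _)

/-- Tests are jointly measurable in two independent parameters; restricting them to the diagonal
gives the claim. -/
theorem _root_.Cones.MCone.IsPath.tmul {p : R} {γ : F.obj p → P.cone} {δ : F.obj p → Q.cone}
    (hγ : P.IsPath p γ) (hδ : Q.IsPath p δ) :
    (T.mobj P Q).IsPath p fun r => T.tmul (γ r) (δ r) :=
  ⟨fun r => T.nrm_tmul_le (hγ.ball r) (hδ.ball r), fun k _ hm => (hm.2 p p γ δ hγ hδ).comp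
    (f := fun x : F.obj p × F.obj k => (x.1, x.1, x.2))
    (measurable_fst.prodMk (measurable_fst.prodMk measurable_snd))⟩

theorem isMeasLin_curry (f : T.mobj P Q ⟶ N) (a : P.cone) :
    MCone.IsMeasLin (T.curry P.cone Q.cone N.cone f.hom a : ContLin Q.cone N.cone) := by
  have key : ∀ a : P.cone, nrm a ≤ 1 →
      (T.curry P.cone Q.cone N.cone f.hom a : ContLin Q.cone N.cone) ∈ MCone.measLin Q N :=
    fun a ha => (MCone.isMeasLin_iff _).2 fun p δ hδ k m hm => by
      have := f.measurable ((MCone.isPath_const p ha).tmul T hδ) hm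
      convert this using 3
      exact T.curry_app f.hom _ _
  -- A constant map is a path only if its value is in the unit ball. So `a` is first divided by `nrm
  -- a + 1`, which is nonzero even for `a = 0`, and the result is scaled back.
  have h0 : nrm a + 1 ≠ 0 := by positivity
  have := (MCone.measLin Q N).smul_mem (nrm a + 1) (key ((nrm a + 1)⁻¹ • a) (by
    rw [nrm_smul, inv_mul_le_iff₀ (pos_iff_ne_zero.2 h0), mul_one]
    exact le_self_add))
  have e : (nrm a + 1) • (T.curry P.cone Q.cone N.cone f.hom ((nrm a + 1)⁻¹ • a) :
      ContLin Q.cone N.cone) = T.curry P.cone Q.cone N.cone f.hom a := by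
    rw [← smul_inv_smul₀ h0 (T.curry P.cone Q.cone N.cone f.hom a)]
    exact congrArg _ ((T.curry P.cone Q.cone N.cone f.hom).lin.map_smul _ a)
  exact (congrArg (MCone.IsMeasLin (P := Q) (Q := N)) e).mp this

/-- Pure tensors of a tensor product of measurable cones. -/
def mtmul (a : P.cone) (b : Q.cone) : (T.mobj P Q).cone := T.tmul a b

theorem mhom_ext {f g : T.mobj P Q ⟶ N} (h : ∀ a b, f (T.mtmul a b) = g (T.mtmul a b)) : f = g :=
  MCone.Hom.ext (T.hom_ext h)

/-- The tensor product of measurable linear maps. -/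
def mmap (f : P ⟶ P') (g : Q ⟶ Q') : T.mobj P Q ⟶ T.mobj P' Q' :=
  ⟨T.tensor.map (Prod.mkHom f.hom g.hom), T.restricts F f g⟩

theorem mmap_mtmul (f : P ⟶ P') (g : Q ⟶ Q') (a : P.cone) (b : Q.cone) :
    T.mmap f g (T.mtmul a b) = T.mtmul (f a) (g b) := T.map_tmul f.hom g.hom a b

/-! #### The symmetry and the units -/

/-- The bilinear map `(a, b) ↦ b ⊗ a`. -/
def flipHom (P Q : SCone.{u}) : P ⟶ (SCone.limpl.obj (.op Q)).obj (T.tensor.obj (Q, P)) where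
  lin :=
    ⟨{ toFun := fun a => (evalAt a).comp (T.tmulLin Q P)
       map_add' := fun a a' => ContLin.ext fun b => T.tmul_add b a a'
       map_smul' := fun c a => ContLin.ext fun b => T.tmul_smul c b a },
      fun _ _ hs ha => isSup_of_pointwise fun b => (T.tmulLin Q P b).isSup hs ha⟩
  ball _ ha := opNrm_le _ fun _ hb => T.nrm_tmul_le hb ha

/-- The braiding. -/
def braidHom (P Q : MCone.{u} F) : T.mobj P Q ⟶ T.mobj Q P where
  hom := (T.curry P.cone Q.cone _).symm (T.flipHom P.cone Q.cone)
  isMeas := T.isMeas_of_tmul (N := T.mobj Q P) fun p q k γ δ hγ hδ m hm => by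
    have := (hm.2 q p δ γ hδ hγ).comp (f := fun x : F.obj p × F.obj q × F.obj k =>
      (x.2.1, x.1, x.2.2)) ((measurable_fst.comp measurable_snd).prodMk
        (measurable_fst.prodMk (measurable_snd.comp measurable_snd)))
    convert this using 2
    exact congrArg _ (T.symm_tmul _ _ _)

theorem braidHom_mtmul (a : P.cone) (b : Q.cone) :
    T.braidHom P Q (T.mtmul a b) = T.mtmul b a := T.symm_tmul _ a b

theorem braidHom_braidHom (P Q : MCone.{u} F) : T.braidHom P Q ≫ T.braidHom Q P = 𝟙 _ :=
  T.mhom_ext fun a b => by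
    rw [MCone.comp_apply, braidHom_mtmul, braidHom_mtmul, MCone.id_apply]

/-- The left unitor. -/
def leftUnitorHom (P : MCone.{u} F) : T.mobj (MCone.one F) P ⟶ P where
  hom := (T.curry SCone.one P.cone P.cone).symm (SCone.smulHom P.cone)
  isMeas := T.isMeas_of_tmul (P := MCone.one F) fun p q k γ δ hγ hδ m hm => by
    -- The only test of the unit is the identity, so a path in it is an ordinary measurable
    -- function.
    have h1 : Measurable fun r => (γ r).down :=
      (hγ.meas p _ rfl).comp (measurable_id.prodMk measurable_id)
    have := (h1.comp measurable_fst).mul ((hδ.meas k m hm).comp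
      (measurable_snd : Measurable (Prod.snd : F.obj p × F.obj q × F.obj k → _)))
    convert this using 1
    ext x
    refine congrArg NNReal.toReal ((congrArg (m x.2.2) (T.symm_tmul _ _ _)).trans ?_)
    exact (m x.2.2).map_smul _ _

theorem leftUnitorHom_mtmul (r : (MCone.one F).cone) (a : P.cone) :
    T.leftUnitorHom P (T.mtmul r a) = (show ULift ℝ≥0 from r).down • a := T.symm_tmul _ r a

/-- The inverse of the left unitor. -/
def leftUnitorInv (P : MCone.{u} F) : P ⟶ T.mobj (MCone.one F) P where
  hom :=
    { lin := T.tmulLin SCone.one P.cone (ULift.up 1)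
      ball := fun _ ha => T.nrm_tmul_le (P := SCone.one) le_rfl ha }
  isMeas p _ hγ := (MCone.isPath_const (P := MCone.one F) p (a := ULift.up 1) le_rfl).tmul T hγ

theorem leftUnitorInv_apply (a : P.cone) :
    T.leftUnitorInv P a = T.mtmul (P := MCone.one F) (ULift.up 1) a := rfl

/-- The left unit isomorphism. -/
def leftUnitorIso (P : MCone.{u} F) : T.mobj (MCone.one F) P ≅ P where
  hom := T.leftUnitorHom P
  inv := T.leftUnitorInv P
  hom_inv_id := T.mhom_ext fun r a => by
    rw [MCone.comp_apply, leftUnitorHom_mtmul, leftUnitorInv_apply, MCone.id_apply]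
    -- `1 ⊗ (r • a) = r • (1 ⊗ a) = (r • 1) ⊗ a`, and `r • 1 = r`.
    refine (T.tmul_smul _ _ a).trans ((T.smul_tmul _ _ a).symm.trans ?_)
    exact congrArg (fun r => T.mtmul (P := MCone.one F) r a) (ULift.ext _ _ (mul_one _))
  inv_hom_id := MCone.hom_ext fun a =>
    (T.leftUnitorHom_mtmul _ a).trans (one_smul _ a)

/-- The symmetry isomorphism. -/
def braidIso (P Q : MCone.{u} F) : T.mobj P Q ≅ T.mobj Q P :=
  ⟨T.braidHom P Q, T.braidHom Q P, T.braidHom_braidHom P Q, T.braidHom_braidHom Q P⟩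

/-! ### Currying of measurable maps -/

section products

variable [HasFiniteProducts R] [PreservesFiniteProducts F]

/-- Currying of measurable linear maps. -/
def mcurry (f : T.mobj P Q ⟶ N) : P ⟶ MCone.limplmObj Q N where
  hom :=
    { lin := MCone.codRestrict (T.curry P.cone Q.cone N.cone f.hom).lin (T.isMeasLin_curry f)
      ball := fun a ha => (T.curry _ _ _ f.hom).ball a ha }
  isMeas p γ hγ := by
    refine ⟨fun r => (T.curry _ _ _ f.hom).ball _ (hγ.ball r), ?_⟩
    rintro q _ ⟨δ, l, hδ, hl, rfl⟩
    -- The paths `γ` and `δ` are pulled back to the arity `p ⨯ q`, where their pure tensor is a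
    -- path; `φ` transports measurability back to `F.obj p × F.obj q`.
    obtain ⟨φ, hφ, hφ'⟩ := MCone.exists_pairing (F := F) p q
    have := (f.measurable ((hγ.precomp prod.fst).tmul T (hδ.precomp prod.snd)) hl).comp
      (hφ.prodMk measurable_snd)
    convert this using 2 with rs
    simp only [Function.comp, (hφ' _).1, (hφ' _).2]
    exact congrArg _ (T.curry_app f.hom _ _)

theorem mcurry_app (f : T.mobj P Q ⟶ N) (a : P.cone) (b : Q.cone) :
    MCone.app (T.mcurry f a) b = f (T.mtmul a b) := T.curry_app f.hom a b

/-- Uncurrying of measurable linear maps. -/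
def muncurry (g : P ⟶ MCone.limplmObj Q N) : T.mobj P Q ⟶ N where
  hom := (T.curry P.cone Q.cone N.cone).symm (g.hom ≫ MCone.inclHom Q N)
  isMeas := T.isMeas_of_tmul fun p q k γ δ hγ hδ m hm => by
    simp only [symm_tmul]
    obtain ⟨φ, hφ, hφ'⟩ := MCone.exists_pairing (F := F) q k
    -- Pulled back to the arity `q ⨯ k`, the path `δ` and the test `m` form a test of the function
    -- space, against which the path `g ∘ γ` is measurable.
    have := (g.measurable hγ (k := q ⨯ k) ⟨_, _, hδ.precomp prod.fst,
      N.precomp k (q ⨯ k) prod.snd m hm, rfl⟩).comp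
      (measurable_fst.prodMk (hφ.comp measurable_snd))
    convert this using 2 with x
    simp only [Function.comp, (hφ' _).1, (hφ' _).2]
    rfl

theorem muncurry_mtmul (g : P ⟶ MCone.limplmObj Q N) (a : P.cone) (b : Q.cone) :
    T.muncurry g (T.mtmul a b) = MCone.app (g a) b := T.symm_tmul _ a b

/-- Currying is a bijection. -/
def mcurryEquiv (P Q N : MCone.{u} F) : (T.mobj P Q ⟶ N) ≃ (P ⟶ MCone.limplmObj Q N) where
  toFun := T.mcurry
  invFun := T.muncurry
  left_inv f := T.mhom_ext fun a b => (T.muncurry_mtmul _ a b).trans (T.mcurry_app f a b)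
  right_inv g := MCone.limplm_hom_ext fun a b =>
    (T.mcurry_app _ a b).trans (T.muncurry_mtmul g a b)

/-- Currying the last variable leaves maps out of a binary tensor product, which are known to be
determined by pure tensors. -/
theorem mhom_ext₃ {f g : T.mobj (T.mobj P Q) N ⟶ M}
    (h : ∀ a b c, f (T.mtmul (T.mtmul a b) c) = g (T.mtmul (T.mtmul a b) c)) : f = g := by
  refine (T.mcurryEquiv _ _ _).injective
    (T.mhom_ext fun a b => Subtype.ext (ContLin.ext fun c => ?_))
  exact (T.mcurry_app f _ c).trans ((h a b c).trans (T.mcurry_app g _ c).symm)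

theorem mhom_ext₄ {L : MCone.{u} F} {f g : T.mobj (T.mobj (T.mobj P Q) N) L ⟶ M}
    (h : ∀ a b c d, f (T.mtmul (T.mtmul (T.mtmul a b) c) d) =
      g (T.mtmul (T.mtmul (T.mtmul a b) c) d)) : f = g := by
  refine (T.mcurryEquiv _ _ _).injective
    (T.mhom_ext₃ fun a b c => Subtype.ext (ContLin.ext fun d => ?_))
  exact (T.mcurry_app f _ d).trans ((h a b c d).trans (T.mcurry_app g _ d).symm)

/-! #### The associator -/

/-- The map `c ↦ h (b ⊗ c)`, as a measurable function of `b`. -/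
def internalCurryFun (h : MCone.measLin (T.mobj Q N) M) :
    MCone.measLin Q (MCone.limplmObj N M) :=
  ⟨MCone.codRestrict (Q := N) (N := M)
    ((ContLin.postcomp (P := N.cone) h.1).comp (T.tmulLin Q.cone N.cone)) fun b =>
      -- The map `c ↦ b ⊗ c` is the curried identity of `Q ⊗ N` at `b`, hence measurable up to a
      -- scalar.
      MCone.isMeasLin_comp h.2 (T.isMeasLin_curry (𝟙 (T.mobj Q N)) b),
    (MCone.isMeasLin_iff (P := Q) (Q := MCone.limplmObj N M) _).2 (by
      rintro p γ hγ q _ ⟨δ, l, hδ, hl, rfl⟩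
      obtain ⟨φ, hφ, hφ'⟩ := MCone.exists_pairing (F := F) p q
      have := (MCone.measLin_meas h ((hγ.precomp prod.fst).tmul T (hδ.precomp prod.snd)) hl).comp
        (hφ.prodMk measurable_snd)
      convert this using 2 with rs
      simp only [Function.comp, (hφ' _).1, (hφ' _).2]
      rfl)⟩

/-- Currying, as a measurable linear map between function spaces. -/
def internalCurry (Q N M : MCone.{u} F) :
    MCone.limplmObj (T.mobj Q N) M ⟶ MCone.limplmObj Q (MCone.limplmObj N M) where
  hom :=
    { lin :=
        ⟨{ toFun := fun h => T.internalCurryFun h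
           map_add' := fun _ _ => rfl
           map_smul' := fun _ _ => rfl },
          fun _ _ hs hh => MCone.measLin_isSup_of (isSup_of_pointwise fun b =>
            MCone.measLin_isSup_of (isSup_of_pointwise fun c =>
              (MCone.measLin_isSup hs hh).apply (MCone.measLin_chain hs) (T.mtmul b c)))⟩
      ball := fun h hh => opNrm_le _ fun b hb => opNrm_le _ fun c hc =>
        (le_opNrm (MCone.inclMeasLin h) (T.nrm_tmul_le hb hc)).trans hh }
  isMeas p θ hθ := by
    refine ⟨fun r => opNrm_le _ fun b hb => opNrm_le _ fun c hc =>
        (le_opNrm (MCone.inclMeasLin (θ r)) (T.nrm_tmul_le hb hc)).trans (hθ.ball r), ?_⟩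
    rintro q _ ⟨γ, _, hγ, ⟨δ, l, hδ, hl, rfl⟩, rfl⟩
    -- The nested test given by `γ`, `δ` and `l` pulls back along currying to the test given by the
    -- path `γ ⊗ δ` and by `l`.
    exact hθ.meas q _ ⟨_, l, hγ.tmul T hδ, hl, rfl⟩

/-- The associator. -/
def assocHom (P Q N : MCone.{u} F) : T.mobj (T.mobj P Q) N ⟶ T.mobj P (T.mobj Q N) :=
  -- The curried identity `a ↦ (z ↦ a ⊗ z)` becomes `a ↦ b ↦ c ↦ a ⊗ (b ⊗ c)` by currying the inner
  -- function, and is then uncurried twice.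
  T.muncurry (T.muncurry (T.mcurry (𝟙 _) ≫ T.internalCurry Q N _))

theorem assocHom_mtmul (a : P.cone) (b : Q.cone) (c : N.cone) :
    T.assocHom P Q N (T.mtmul (T.mtmul a b) c) = T.mtmul a (T.mtmul b c) := by
  refine (T.muncurry_mtmul _ _ c).trans ?_
  refine (congrArg (fun f => MCone.app f c) (T.muncurry_mtmul _ a b)).trans ?_
  exact T.mcurry_app (𝟙 _) a (T.mtmul b c)

/-- Precomposing with the braiding, which is invertible, reduces this bracketing to the other one.
-/
theorem mhom_ext₃' {f g : T.mobj P (T.mobj Q N) ⟶ M}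
    (h : ∀ a b c, f (T.mtmul a (T.mtmul b c)) = g (T.mtmul a (T.mtmul b c))) : f = g := by
  have e : T.braidHom _ P ≫ f = T.braidHom _ P ≫ g := T.mhom_ext₃ fun b c a => by
    simp only [MCone.comp_apply, braidHom_mtmul, h]
  rw [← Category.id_comp f, ← Category.id_comp g, ← T.braidHom_braidHom, Category.assoc, e,
    Category.assoc]

/-- The inverse of the associator. -/
def assocInv (P Q N : MCone.{u} F) : T.mobj P (T.mobj Q N) ⟶ T.mobj (T.mobj P Q) N :=
  -- The symmetry spares a second construction: `a ⊗ (b ⊗ c) ↦ a ⊗ (c ⊗ b) ↦ (c ⊗ b) ⊗ a ↦ c ⊗ (b ⊗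
  -- a) ↦ (b ⊗ a) ⊗ c ↦ (a ⊗ b) ⊗ c`.
  T.mmap (𝟙 P) (T.braidHom Q N) ≫ T.braidHom P (T.mobj N Q) ≫ T.assocHom N Q P ≫
    T.braidHom N (T.mobj Q P) ≫ T.mmap (T.braidHom Q P) (𝟙 N)

theorem assocInv_mtmul (a : P.cone) (b : Q.cone) (c : N.cone) :
    T.assocInv P Q N (T.mtmul a (T.mtmul b c)) = T.mtmul (T.mtmul a b) c := by
  simp only [assocInv, MCone.comp_apply, mmap_mtmul, braidHom_mtmul, assocHom_mtmul,
    MCone.id_apply]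

/-- The associativity isomorphism. -/
def assocIso (P Q N : MCone.{u} F) : T.mobj (T.mobj P Q) N ≅ T.mobj P (T.mobj Q N) where
  hom := T.assocHom P Q N
  inv := T.assocInv P Q N
  hom_inv_id := T.mhom_ext₃ fun a b c => by
    simp only [MCone.comp_apply, assocHom_mtmul, assocInv_mtmul, MCone.id_apply]
  inv_hom_id := T.mhom_ext₃' fun a b c => by
    simp only [MCone.comp_apply, assocHom_mtmul, assocInv_mtmul, MCone.id_apply]

/-! ### Coherence laws -/

/-- The symmetric monoidal structure of the category of measurable cones. -/
def monoidalStructure (hT : T.Restricts F) :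
    SymmetricMonoidalStructure (T.mfunctor hT) (MCone.one F) where
  assoc := T.assocIso
  leftUnitor := T.leftUnitorIso
  rightUnitor P := T.braidIso P (MCone.one F) ≪≫ T.leftUnitorIso P
  braiding := T.braidIso
  assoc_natural f g h := by
    -- Here and below, the law is restated with `T.mmap` so that the formulas on pure tensors apply;
    -- both sides then agree on pure tensors.
    change T.mmap (T.mmap f g) h ≫ T.assocHom _ _ _ = T.assocHom _ _ _ ≫ T.mmap f (T.mmap g h)
    refine T.mhom_ext₃ fun a b c => ?_
    simp only [MCone.comp_apply, mmap_mtmul, assocHom_mtmul]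
  leftUnitor_natural f := by
    change T.mmap (𝟙 _) f ≫ T.leftUnitorHom _ = T.leftUnitorHom _ ≫ f
    refine T.mhom_ext fun r a => ?_
    rw [MCone.comp_apply, MCone.comp_apply, mmap_mtmul, leftUnitorHom_mtmul, leftUnitorHom_mtmul]
    exact (f.hom.lin.map_smul _ a).symm
  rightUnitor_natural f := by
    change T.mmap f (𝟙 _) ≫ T.braidHom _ _ ≫ T.leftUnitorHom _ =
      (T.braidHom _ _ ≫ T.leftUnitorHom _) ≫ f
    refine T.mhom_ext fun a r => ?_
    simp only [MCone.comp_apply, mmap_mtmul, braidHom_mtmul, leftUnitorHom_mtmul]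
    exact (f.hom.lin.map_smul _ a).symm
  braiding_natural f g := by
    change T.mmap f g ≫ T.braidHom _ _ = T.braidHom _ _ ≫ T.mmap g f
    refine T.mhom_ext fun a b => ?_
    simp only [MCone.comp_apply, mmap_mtmul, braidHom_mtmul]
  pentagon W X Y Z := by
    change T.mmap (T.assocHom W X Y) (𝟙 Z) ≫ T.assocHom W (T.mobj X Y) Z ≫
      T.mmap (𝟙 W) (T.assocHom X Y Z) = T.assocHom (T.mobj W X) Y Z ≫ T.assocHom W X (T.mobj Y Z)
    refine T.mhom_ext₄ fun a b c d => ?_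
    simp only [MCone.comp_apply, mmap_mtmul, assocHom_mtmul, MCone.id_apply]
  triangle X Y := by
    change T.assocHom X (MCone.one F) Y ≫ T.mmap (𝟙 X) (T.leftUnitorHom Y) =
      T.mmap (T.braidHom _ _ ≫ T.leftUnitorHom X) (𝟙 Y)
    refine T.mhom_ext₃ fun a r b => ?_
    simp only [MCone.comp_apply, mmap_mtmul, assocHom_mtmul, braidHom_mtmul, leftUnitorHom_mtmul,
      MCone.id_apply]
    -- Bilinearity: `a ⊗ (r • b) = (r • a) ⊗ b`.
    exact (T.tmul_smul _ a b).trans (T.smul_tmul _ a b).symm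
  hexagon X Y Z := by
    change T.assocHom X Y Z ≫ T.braidHom X (T.mobj Y Z) ≫ T.assocHom Y Z X =
      T.mmap (T.braidHom X Y) (𝟙 Z) ≫ T.assocHom Y X Z ≫ T.mmap (𝟙 Y) (T.braidHom X Z)
    refine T.mhom_ext₃ fun a b c => ?_
    simp only [MCone.comp_apply, mmap_mtmul, assocHom_mtmul, braidHom_mtmul, MCone.id_apply]
  symmetry := T.braidHom_braidHom

end products

end measurability

end ConeTensor

end Cones

end

/-! ### The main theorem -/

theorem mainTheorem11 {R : Type w} [Category.{x} R] [HasFiniteProducts R]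
    (F : R ⥤ MeasCat.{v}) [PreservesFiniteProducts F] :
    Nonempty Cones.ConeTensor.{u} ∧
    ∀ T : Cones.ConeTensor.{u}, ∃ hT : T.Restricts F,
      ∃ S : Cones.SymmetricMonoidalStructure (T.mfunctor hT) (Cones.MCone.one F),
        (∀ (P Q N : Cones.MCone.{u} F) (a : P.cone) (b : Q.cone) (c : N.cone),
          (S.assoc P Q N).hom (T.tmul (T.tmul a b) c) = T.tmul a (T.tmul b c)) ∧
        (∀ (P : Cones.MCone.{u} F) (r : ℝ≥0) (a : P.cone),
          (S.leftUnitor P).hom (T.tmul (P := Cones.SCone.one) (ULift.up r) a) = r • a) ∧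
        (∀ (P : Cones.MCone.{u} F) (r : ℝ≥0) (a : P.cone),
          (S.rightUnitor P).hom (T.tmul (Q := Cones.SCone.one) a (ULift.up r)) = r • a) ∧
        (∀ (P Q : Cones.MCone.{u} F) (a : P.cone) (b : Q.cone),
          (S.braiding P Q).hom (T.tmul a b) = T.tmul b a) ∧
        letI := S.toMonoidalCategory
        ∃ adj : ∀ Q : Cones.MCone.{u} F,
            MonoidalCategory.tensorRight Q ⊣ Cones.MCone.limplm.obj (Opposite.op Q),
          ∀ (P Q N : Cones.MCone.{u} F) (f : (T.mfunctor hT).obj (P, Q) ⟶ N)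
            (a : P.cone) (b : Q.cone),
            Cones.MCone.app ((adj Q).homEquiv P N f a) b = f (T.tmul a b) := by
  refine ⟨⟨Cones.TensorConstruction.coneTensor⟩, fun T => ⟨T.restricts F,
    T.monoidalStructure (T.restricts F), fun P Q N => T.assocHom_mtmul,
    fun P r => T.leftUnitorHom_mtmul (ULift.up r), fun P r a => ?_,
    fun P Q => T.braidHom_mtmul, ?_⟩⟩
  -- The right unitor is the braiding followed by the left unitor.
  · exact (congrArg (T.leftUnitorHom P).hom.lin (T.braidHom_mtmul a (ULift.up r))).trans
      (T.leftUnitorHom_mtmul (ULift.up r) a)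
  · let := (T.monoidalStructure (T.restricts F)).toMonoidalCategory
    refine ⟨fun Q => Adjunction.mkOfHomEquiv
      { homEquiv := fun P N => T.mcurryEquiv P Q N
        homEquiv_naturality_left_symm := fun {P' P N} f g => T.mhom_ext fun a b => ?_
        homEquiv_naturality_right := fun {P N N'} f g =>
          Cones.MCone.limplm_hom_ext fun a b => ?_ }, fun P Q N f a b => ?_⟩
    · exact (T.muncurry_mtmul (f ≫ g) a b).trans ((T.muncurry_mtmul g (f a) b).symm.trans
        (congrArg (T.muncurry g).hom.lin (T.mmap_mtmul f (𝟙 Q) a b).symm))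
    · exact (T.mcurry_app (f ≫ g) a b).trans (congrArg g.hom.lin (T.mcurry_app f a b).symm)
    · rw [Adjunction.mkOfHomEquiv_homEquiv]
      exact T.mcurry_app f a b
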